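/- **Setting.** Let $k\ge 1$, $n>k$, and let $x_1,\dots,x_n\in\mathbb R^k$ be observed return vectors which, given a mean vector $\mu\in\mathbb R^k$ and a positive definite covariance matrix $\Sigma\in\mathbb R^{k\times k}$, are independent with distribution $\mathcal N_k(\mu,\Sigma)$. For a prior $\pi(\mu,\Sigma)$ (a density with respect to Lebesgue measure $d\mu\,d\Sigma$, with $\Sigma$ ranging over the positive definite matrices) the posterior is the probability distribution with density proportional to $\pi(\mu,\Sigma)\prod_{i=1}^n\varphi_{\mu,\Sigma}(x_i)$, where $\varphi_{\mu,\Sigma}$ is the density of $\mathcal N_k(\mu,\Sigma)$. Write $\bar x=\frac1n\sum_i x_i$ and $S_d=\sum_{i=1}^n(x_i-\bar x)(x_i-\bar x)^\top$. Let $t<T$ be time points, $\gamma>0$ the risk aversion, $W_t$ the wealth at time $t$, $r_{f,i}$ the risk-free returns, $C_t=\big(\gamma W_t\prod_{i=t+2}^T(1+r_{f,i})\big)^{-1}$ (all non-random, the empty product being $1$), and let $$w_t=C_t\,\Sigma^{-1}(\mu-r_{f,t+1}\mathbf 1)$$ be the multi-period optimal portfolio weights. Let $L$ be a $p\times k$ matrix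 of constants, and let $t_k(d,a,A)$ denote the $k$-variate $t$-distribution with $d$ degrees of freedom, location $a$ and dispersion matrix $A$. **Theorem.** (a) *Diffuse (Jeffreys) prior* $\pi(\mu,\Sigma)\propto|\Sigma|^{-(k+1)/2}$. Suppose that $S_d$ is positive definite. Then the posterior is proper and under it $$L w_t\overset{d}{=}C_t\,\eta\,L S^*(\mu)^{-1}v+C_t\sqrt{\eta}\,\Big(v^\top S^*(\mu)^{-1}v\cdot L S^*(\mu)^{-1}L^\top-L S^*(\mu)^{-1}v\,v^\top S^*(\mu)^{-1}L^\top\Big)^{1/2}z_0,\qquad v=\mu-r_{f,t+1}\mathbf 1,\tag{$*$}$$ with $S^*(\mu)=S_d+n(\mu-\bar x)(\mu-\bar x)^\top$, where on the right-hand side $\eta\sim\chi^2_n$, $z_0\sim\mathcal N_p(0,I_p)$ and $\mu\sim t_k\big(n-k,\ \bar x,\ \tfrac{1}{n(n-k)}S_d\big)$ are mutually independent; this $t$-distribution is the marginal posterior of $\mu$. The exponent $1/2$ denotes the positive semidefinite square root. (b) *Conjugate prior* $\mu\mid\Sigma\sim\mathcal N_k(m_0,\Sigma/r_0)$, $\Sigma\sim\mathcal{IW}_k(d_0,S_0)$,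 where $m_0\in\mathbb R^k$, $r_0>0$, $d_0>2k$, $S_0$ is positive definite, and $\mathcal{IW}_k(d_0,S_0)$ has density proportional to $|\Sigma|^{-d_0/2}\exp\{-\tfrac12\mathrm{tr}(\Sigma^{-1}S_0)\}$. Put $$\bar x_c=\frac{n\bar x+r_0m_0}{n+r_0},\qquad S_c=S_d+S_0+\frac{n r_0}{n+r_0}(m_0-\bar x)(m_0-\bar x)^\top .$$ Then the posterior is proper and under it $(*)$ holds with $S^*(\mu)=S_c+(n+r_0)(\mu-\bar x_c)(\mu-\bar x_c)^\top$, where now on the right-hand side $\eta\sim\chi^2_{n+d_0-k}$, $z_0\sim\mathcal N_p(0,I_p)$ and $\mu\sim t_k\big(n+d_0-2k,\ \bar x_c,\ \tfrac{1}{(n+r_0)(n+d_0-2k)}S_c\big)$ are mutually independent; this $t$-distribution is the marginal posterior of $\mu$. -/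

import Mathlib

open MeasureTheory ProbabilityTheory Matrix
open scoped MatrixOrder ENNReal

noncomputable section

namespace BayesPortfolio

/-! ### Lebesgue measure on symmetric matrices and the distributions involved -/

/-- The symmetric matrix with prescribed entries on and above the diagonal. -/
def symMatrix {k : ℕ} (u : {q : Fin k × Fin k // q.1 ≤ q.2} → ℝ) : Matrix (Fin k) (Fin k) ℝ :=
  Matrix.of fun i j => u ⟨(min i j, max i j), min_le_max⟩

/-- The σ-algebra on real matrices generated by the entries. -/
instance matrixMeasurableSpace {m n : ℕ} : MeasurableSpace (Matrix (Fin m) (Fin n) ℝ) :=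
  inferInstanceAs (MeasurableSpace (Fin m → Fin n → ℝ))

/-- The reference measure `dμ dΣ` on pairs `(μ, Σ)`: Lebesgue measure on `ℝᵏ` for `μ`, and
for `Σ` Lebesgue measure in the `k (k + 1) / 2` entries on and above the diagonal, restricted
to the cone of positive definite matrices. -/
def refMeasure (k : ℕ) : Measure ((Fin k → ℝ) × Matrix (Fin k) (Fin k) ℝ) :=
  (volume : Measure (Fin k → ℝ)).prod
    (((volume : Measure ({q : Fin k × Fin k // q.1 ≤ q.2} → ℝ)).map symMatrix).restrict
      {S | S.PosDef})

/-- The density at `y` of the normal distribution `N_k(m, S)`, for `S` positive definite. -/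
def normalDensity {k : ℕ} (m : Fin k → ℝ) (S : Matrix (Fin k) (Fin k) ℝ) (y : Fin k → ℝ) : ℝ :=
  (2 * Real.pi) ^ (-(k : ℝ) / 2) * S.det ^ (-(1 : ℝ) / 2) *
    Real.exp (-((y - m) ⬝ᵥ (S⁻¹ *ᵥ (y - m))) / 2)

/-- The multivariate gamma function `Γ_k(a) = π^(k(k-1)/4) ∏_{i=1}^k Γ(a - (i-1)/2)`. -/
def multiGamma (k : ℕ) (a : ℝ) : ℝ :=
  Real.pi ^ ((k : ℝ) * ((k : ℝ) - 1) / 4) * ∏ i : Fin k, Real.Gamma (a - ((i : ℕ) : ℝ) / 2)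

/-- The density at `S` of the inverse Wishart distribution `IW_k(d, Ψ)`, for `d > 2k` and `Ψ`
positive definite, in the parametrization where it is proportional to
`|S|^(-d/2) exp(-tr(S⁻¹ Ψ)/2)`. -/
def invWishartDensity {k : ℕ} (d : ℝ) (Ψ S : Matrix (Fin k) (Fin k) ℝ) : ℝ :=
  Ψ.det ^ ((d - k - 1) / 2) / (2 ^ ((k : ℝ) * (d - k - 1) / 2) * multiGamma k ((d - k - 1) / 2)) *
    S.det ^ (-d / 2) * Real.exp (-(S⁻¹ * Ψ).trace / 2)

/-- The multivariate `t`-distribution `t_k(d, a, A)` with `d` degrees of freedom, location `a`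
and dispersion matrix `A`. -/
def multiT {k : ℕ} (d : ℝ) (a : Fin k → ℝ) (A : Matrix (Fin k) (Fin k) ℝ) :
    Measure (Fin k → ℝ) :=
  volume.withDensity fun y => ENNReal.ofReal
    (Real.Gamma ((d + k) / 2) /
        (Real.Gamma (d / 2) * (d * Real.pi) ^ ((k : ℝ) / 2) * A.det ^ ((1 : ℝ) / 2)) *
      (1 + (y - a) ⬝ᵥ (A⁻¹ *ᵥ (y - a)) / d) ^ (-(d + k) / 2))

/-- The `χ²`-distribution with `d` degrees of freedom. -/
def chiSquared (d : ℝ) : Measure ℝ := gammaMeasure (d / 2) (1 / 2)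

/-! ### Priors and posteriors -/

/-- The diffuse (Jeffreys) prior, with density `|Σ|^(-(k+1)/2)`; it has infinite mass. -/
def diffusePrior (k : ℕ) : Measure ((Fin k → ℝ) × Matrix (Fin k) (Fin k) ℝ) :=
  (refMeasure k).withDensity fun θ => ENNReal.ofReal (θ.2.det ^ (-((k : ℝ) + 1) / 2))

/-- The conjugate prior: `μ | Σ ~ N_k(m₀, Σ / r₀)` and `Σ ~ IW_k(d₀, S₀)`. -/
def conjugatePrior {k : ℕ} (m₀ : Fin k → ℝ) (r₀ d₀ : ℝ) (S₀ : Matrix (Fin k) (Fin k) ℝ) :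
    Measure ((Fin k → ℝ) × Matrix (Fin k) (Fin k) ℝ) :=
  (refMeasure k).withDensity fun θ => ENNReal.ofReal
    (normalDensity m₀ (r₀⁻¹ • θ.2) θ.1 * invWishartDensity d₀ S₀ θ.2)

/-- The likelihood of the parameter `θ = (μ, Σ)` for observations `x` that are independent
`N_k(μ, Σ)` vectors given `(μ, Σ)`. -/
def likelihood {k n : ℕ} (x : Fin n → Fin k → ℝ)
    (θ : (Fin k → ℝ) × Matrix (Fin k) (Fin k) ℝ) : ℝ :=
  ∏ i, normalDensity θ.1 θ.2 (x i)

/-- The posterior given `x`: likelihood times prior, normalized to total mass one. -/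
def posterior {k n : ℕ} (prior : Measure ((Fin k → ℝ) × Matrix (Fin k) (Fin k) ℝ))
    (x : Fin n → Fin k → ℝ) : Measure ((Fin k → ℝ) × Matrix (Fin k) (Fin k) ℝ) :=
  (∫⁻ θ, ENNReal.ofReal (likelihood x θ) ∂prior)⁻¹ •
    prior.withDensity fun θ => ENNReal.ofReal (likelihood x θ)

/-! ### Sample statistics -/

/-- The sample mean `x̄`. -/
def sampleMean {k n : ℕ} (x : Fin n → Fin k → ℝ) : Fin k → ℝ :=
  (n : ℝ)⁻¹ • ∑ i, x i

/-- The sample covariance matrix, with the factor `1 / (n - 1)`. -/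
def sampleCov {k n : ℕ} (x : Fin n → Fin k → ℝ) : Matrix (Fin k) (Fin k) ℝ :=
  ((n : ℝ) - 1)⁻¹ • ∑ i, vecMulVec (x i - sampleMean x) (x i - sampleMean x)

/-- `S_d = (n - 1) S`. -/
def scaleD {k n : ℕ} (x : Fin n → Fin k → ℝ) : Matrix (Fin k) (Fin k) ℝ :=
  ((n : ℝ) - 1) • sampleCov x

/-- `S_d*(μ) = S_d + n (μ - x̄)(μ - x̄)ᵀ`. -/
def scaleDStar {k n : ℕ} (x : Fin n → Fin k → ℝ) (μ : Fin k → ℝ) : Matrix (Fin k) (Fin k) ℝ :=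
  scaleD x + (n : ℝ) • vecMulVec (μ - sampleMean x) (μ - sampleMean x)

/-- `x̄_c = (n x̄ + r₀ m₀) / (n + r₀)`. -/
def meanC {k n : ℕ} (m₀ : Fin k → ℝ) (r₀ : ℝ) (x : Fin n → Fin k → ℝ) : Fin k → ℝ :=
  ((n : ℝ) + r₀)⁻¹ • ((n : ℝ) • sampleMean x + r₀ • m₀)

/-- `S_c = S_d + S₀ + (n r₀ / (n + r₀)) (m₀ - x̄)(m₀ - x̄)ᵀ`. -/
def scaleC {k n : ℕ} (m₀ : Fin k → ℝ) (r₀ : ℝ) (S₀ : Matrix (Fin k) (Fin k) ℝ)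
    (x : Fin n → Fin k → ℝ) : Matrix (Fin k) (Fin k) ℝ :=
  scaleD x + S₀ +
    ((n : ℝ) * r₀ / ((n : ℝ) + r₀)) • vecMulVec (m₀ - sampleMean x) (m₀ - sampleMean x)

/-- `S_c*(μ) = S_c + (n + r₀) (μ - x̄_c)(μ - x̄_c)ᵀ`. -/
def scaleCStar {k n : ℕ} (m₀ : Fin k → ℝ) (r₀ : ℝ) (S₀ : Matrix (Fin k) (Fin k) ℝ)
    (x : Fin n → Fin k → ℝ) (μ : Fin k → ℝ) : Matrix (Fin k) (Fin k) ℝ :=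
  scaleC m₀ r₀ S₀ x + ((n : ℝ) + r₀) • vecMulVec (μ - meanC m₀ r₀ x) (μ - meanC m₀ r₀ x)

/-! ### Portfolio weights and the stochastic representation -/

/-- `C_t = (γ W_t ∏_{i=t+2}^T R_{f,i})⁻¹` with `R_{f,i} = 1 + r_{f,i}`. -/
def riskCoeff (γ : ℝ) (W rf : ℕ → ℝ) (T t : ℕ) : ℝ :=
  (γ * W t * ∏ i ∈ Finset.Icc (t + 2) T, (1 + rf i))⁻¹

/-- The optimal weights `w_t = C_t Σ⁻¹ (μ - r_{f,t+1} 𝟏)` for the parameter `θ = (μ, Σ)`. -/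
def optWeights {k : ℕ} (γ : ℝ) (W rf : ℕ → ℝ) (T t : ℕ)
    (θ : (Fin k → ℝ) × Matrix (Fin k) (Fin k) ℝ) : Fin k → ℝ :=
  riskCoeff γ W rf T t • (θ.2⁻¹ *ᵥ (θ.1 - rf (t + 1) • (1 : Fin k → ℝ)))

/-- The random vector
`C η L V v + C √η (vᵀ V v · L V Lᵀ - L V v vᵀ V Lᵀ)^(1/2) z₀` with `V = S*(μ)⁻¹` and
`v = μ - r 𝟏`, as a function of `(η, z₀, μ)`; the square root is the positive semidefinite one. -/
def stochRep {k p : ℕ} (C r : ℝ) (L : Matrix (Fin p) (Fin k) ℝ)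
    (Sstar : (Fin k → ℝ) → Matrix (Fin k) (Fin k) ℝ)
    (ω : ℝ × EuclideanSpace ℝ (Fin p) × (Fin k → ℝ)) : Fin p → ℝ :=
  let η := ω.1
  let z₀ := ω.2.1
  let μ := ω.2.2
  let V := (Sstar μ)⁻¹
  let v := μ - r • (1 : Fin k → ℝ)
  (C * η) • ((L * V) *ᵥ v) +
    (C * Real.sqrt η) •
      (CFC.sqrt ((v ⬝ᵥ (V *ᵥ v)) • (L * V * Lᵀ) - L * V * vecMulVec v v * V * Lᵀ) *ᵥ z₀.ofLp)

end BayesPortfolio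

end

/-!
Given `μ`, the posterior law of `Σ` is inverse Wishart with scale `S*(μ)`. The congruence
`Σ ↦ A Σ Aᵀ` with `A Aᵀ = S*(μ)` and `v = a • A e₁` (a square root times a Householder reflection)
reduces it to the scale `1` and the direction `e₁`. Splitting off the first row and column of `Σ`
through the Schur complement `s` and the regression coefficients `β` gives `Σ⁻¹ e₁ = s⁻¹ (1, -β)`,
and in the variables `η = 1 / s`, `z = -√η β` the inverse Wishart kernel is that of a `χ²` variable
and of an independent standard Gaussian vector. Transforming back, `L Σ⁻¹ v` is, given `η`, Gaussian
with covariance `η (v ⬝ S*⁻¹ v • L S*⁻¹ Lᵀ - L S*⁻¹ v (L S*⁻¹ v)ᵀ)`, whence the square root in the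
representation. Integrating `Σ` out leaves `|S*(μ)| ^ (-ν / 2)`, which the matrix determinant lemma
identifies as a multivariate `t` kernel. Both posteriors are of this normal-inverse-Wishart form by
conjugacy, the diffuse prior being the improper member `ν = 0`, `r₀ = 0`, `S₀ = 0` of the family.
-/

noncomputable section

namespace BayesPortfolio

/-! ### Bordered matrices -/

/-- The block matrix with upper left entry `c`, first row `b`, first column `d` and lower right
block `T`: the form in which a first coordinate is split off from the others. -/
def bordered {k : ℕ} (c : ℝ) (b d : Fin k → ℝ) (T : Matrix (Fin k) (Fin k) ℝ) :
    Matrix (Fin (k + 1)) (Fin (k + 1)) ℝ :=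
  Matrix.of (Fin.cons (Fin.cons c b) fun i => Fin.cons (d i) (T i))

/-- The symmetric matrix with lower right block `T`, regression coefficients `β` of the first
coordinate on the others, and Schur complement (residual variance) `s`. -/
def schurMatrix {k : ℕ} (s : ℝ) (β : Fin k → ℝ) (T : Matrix (Fin k) (Fin k) ℝ) :
    Matrix (Fin (k + 1)) (Fin (k + 1)) ℝ :=
  bordered (s + β ⬝ᵥ (T *ᵥ β)) (T *ᵥ β) (T *ᵥ β) T

section bordered

variable {k : ℕ} (c c' : ℝ) (b b' d d' : Fin k → ℝ) (T T' : Matrix (Fin k) (Fin k) ℝ)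

@[simp] lemma bordered_zero_zero : bordered c b d T 0 0 = c := rfl
@[simp] lemma bordered_zero_succ (j : Fin k) : bordered c b d T 0 j.succ = b j := rfl
@[simp] lemma bordered_succ_zero (i : Fin k) : bordered c b d T i.succ 0 = d i := rfl
@[simp] lemma bordered_succ_succ (i j : Fin k) : bordered c b d T i.succ j.succ = T i j := rfl

lemma transpose_bordered : (bordered c b d T)ᵀ = bordered c d b Tᵀ := by
  ext i j
  cases i using Fin.cases <;> cases j using Fin.cases <;> rfl

lemma bordered_mul_bordered :
    bordered c b d T * bordered c' b' d' T' =
      bordered (c * c' + b ⬝ᵥ d') (c • b' + b ᵥ* T') (c' • d + T *ᵥ d')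
        (vecMulVec d b' + T * T') := by
  ext i j
  cases i using Fin.cases <;> cases j using Fin.cases <;>
    simp [Matrix.mul_apply, Fin.sum_univ_succ, dotProduct, vecMul, mulVec, vecMulVec_apply,
      mul_comm c']

lemma bordered_one_zero_one : bordered 1 0 0 (1 : Matrix (Fin k) (Fin k) ℝ) = 1 := by
  ext i j
  cases i using Fin.cases <;> cases j using Fin.cases <;>
    simp [Matrix.one_apply, (Fin.succ_ne_zero _).symm]

lemma bordered_mulVec_cons (a : ℝ) (y : Fin k → ℝ) :
    bordered c b d T *ᵥ (Fin.cons a y : Fin (k + 1) → ℝ) =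
      (Fin.cons (c * a + b ⬝ᵥ y) (a • d + T *ᵥ y) : Fin (k + 1) → ℝ) := by
  ext i
  cases i using Fin.cases <;>
    simp [mulVec, dotProduct, Fin.sum_univ_succ, mul_comm a]

lemma trace_bordered : (bordered c b d T).trace = c + T.trace := by
  simp [Matrix.trace, Fin.sum_univ_succ]

lemma det_bordered_zero_col : (bordered c b 0 T).det = c * T.det := by
  have hsub : (bordered c b 0 T).submatrix Fin.succ Fin.succ = T := rfl
  simp [Matrix.det_succ_column_zero, Fin.sum_univ_succ, hsub]

lemma posDef_bordered_zero_iff : (bordered c 0 0 T).PosDef ↔ 0 < c ∧ T.PosDef := by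
  have hform (a : ℝ) (y : Fin k → ℝ) :
      (Fin.cons a y : Fin (k + 1) → ℝ) ⬝ᵥ
        (bordered c 0 0 T *ᵥ (Fin.cons a y : Fin (k + 1) → ℝ)) = c * a ^ 2 + y ⬝ᵥ (T *ᵥ y) := by
    rw [bordered_mulVec_cons, dotProduct, Fin.sum_univ_succ]
    simp [dotProduct]
    ring
  refine ⟨fun h => ⟨h.diag_pos (i := 0), h.submatrix (Fin.succ_injective k)⟩, fun ⟨hc, hT⟩ => ?_⟩
  refine .of_dotProduct_mulVec_pos ?_ fun x hx => ?_
  · rw [isHermitian_iff_isSymm, IsSymm, transpose_bordered, (isHermitian_iff_isSymm.1 hT.1).eq]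
  · cases x using Fin.consCases with
    | cons a y =>
      rw [star_trivial, hform]
      rcases eq_or_ne y 0 with rfl | hy
      · have ha : a ≠ 0 := by
          rintro rfl
          exact hx (funext (Fin.cases rfl fun _ => rfl))
        simpa using mul_pos hc (sq_pos_of_ne_zero ha)
      · exact add_pos_of_nonneg_of_pos (by positivity) (hT.dotProduct_mulVec_pos hy)

variable {s : ℝ} {β : Fin k → ℝ} {c b d T}

lemma posDef_of_posDef_bordered (h : (bordered c b d T).PosDef) : T.PosDef :=
  h.submatrix (Fin.succ_injective k)

lemma schurMatrix_eq_mul (hT : T.IsSymm) :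
    schurMatrix s β T = bordered 1 β 0 1 * bordered s 0 0 T * (bordered 1 β 0 1)ᵀ := by
  have hβ : β ᵥ* T = T *ᵥ β := by rw [← mulVec_transpose, hT.eq]
  simp [schurMatrix, transpose_bordered, bordered_mul_bordered, hβ, dotProduct_comm β]

lemma det_schurMatrix (hT : T.IsSymm) : (schurMatrix s β T).det = s * T.det := by
  simp [schurMatrix_eq_mul hT, det_bordered_zero_col]

lemma posDef_schurMatrix_iff (hT : T.IsSymm) :
    (schurMatrix s β T).PosDef ↔ 0 < s ∧ T.PosDef := by
  have hunit : IsUnit (bordered 1 β 0 (1 : Matrix (Fin k) (Fin k) ℝ)) :=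
    (isUnit_iff_isUnit_det _).2 (by simp [det_bordered_zero_col])
  rw [schurMatrix_eq_mul hT, ← posDef_bordered_zero_iff,
    ← conjTranspose_eq_transpose_of_trivial, ← star_eq_conjTranspose]
  exact hunit.posDef_star_right_conjugate_iff

lemma schurMatrix_inv (hs : s ≠ 0) (hT : T.IsSymm) (hdet : IsUnit T.det) :
    (schurMatrix s β T)⁻¹ =
      bordered s⁻¹ (-(s⁻¹ • β)) (-(s⁻¹ • β)) (T⁻¹ + s⁻¹ • vecMulVec β β) := by
  have hcancel : (T *ᵥ β) ᵥ* T⁻¹ = β := by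
    rw [← vecMul_transpose, hT.eq, vecMul_vecMul, T.mul_nonsing_inv hdet, vecMul_one]
  have hcomm : T *ᵥ β ⬝ᵥ β = β ⬝ᵥ T *ᵥ β := dotProduct_comm _ _
  refine Matrix.inv_eq_right_inv ?_
  rw [schurMatrix, bordered_mul_bordered, ← bordered_one_zero_one]
  congr 1
  · simp [hcomm]
    field_simp
    ring
  · simp only [vecMul_add, vecMul_smul, vecMul_vecMulVec, hcancel, hcomm]
    ext i
    simp
    field_simp
    ring
  · simp [mulVec_neg, mulVec_smul]
  · simp [mul_add, T.mul_nonsing_inv hdet, mul_vecMulVec, vecMulVec_neg, vecMulVec_smul]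

lemma trace_schurMatrix_inv (hs : s ≠ 0) (hT : T.IsSymm) (hdet : IsUnit T.det) :
    (schurMatrix s β T)⁻¹.trace = T⁻¹.trace + s⁻¹ * (1 + β ⬝ᵥ β) := by
  rw [schurMatrix_inv hs hT hdet, trace_bordered, trace_add, trace_smul, trace_vecMulVec,
    smul_eq_mul]
  ring

lemma schurMatrix_inv_mulVec_single (hs : s ≠ 0) (hT : T.IsSymm) (hdet : IsUnit T.det) :
    (schurMatrix s β T)⁻¹ *ᵥ Pi.single 0 1 = s⁻¹ • (Fin.cons 1 (-β) : Fin (k + 1) → ℝ) := by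
  rw [schurMatrix_inv hs hT hdet, mulVec_single_one]
  ext i
  cases i using Fin.cases <;> simp [col_apply]

end bordered

/-! ### Lebesgue measure on positive definite matrices -/

instance matrixBorelSpace {m n : ℕ} : BorelSpace (Matrix (Fin m) (Fin n) ℝ) :=
  inferInstanceAs (BorelSpace (Fin m → Fin n → ℝ))

lemma isClosed_setOf_posSemidef {ι : Type*} [Finite ι] :
    IsClosed {S : Matrix ι ι ℝ | S.PosSemidef} := by
  have := Fintype.ofFinite ι
  simp only [Matrix.posSemidef_iff_dotProduct_mulVec, Matrix.IsHermitian, Set.ofPred_and,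
    Set.ofPred_forall]
  exact (isClosed_eq (by fun_prop) continuous_id).inter
    (isClosed_iInter fun x => isClosed_le continuous_const (by fun_prop))

lemma measurableSet_posDef (k : ℕ) :
    MeasurableSet {S : Matrix (Fin k) (Fin k) ℝ | S.PosDef} := by
  have hset : {S : Matrix (Fin k) (Fin k) ℝ | S.PosDef} =
      {S | S.PosSemidef} ∩ {S | S.det = 0}ᶜ :=
    Set.ext fun S => ⟨fun h => ⟨h.posSemidef, h.det_pos.ne'⟩,
      fun h => h.1.posDef_iff_det_ne_zero.2 h.2⟩
  rw [hset]
  exact isClosed_setOf_posSemidef.measurableSet.inter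
    (isClosed_eq (by fun_prop) continuous_const).measurableSet.compl

lemma measurable_matrix_det (k : ℕ) : Measurable fun S : Matrix (Fin k) (Fin k) ℝ => S.det :=
  Continuous.measurable (by fun_prop)

lemma measurable_matrix_inv (k : ℕ) : Measurable fun S : Matrix (Fin k) (Fin k) ℝ => S⁻¹ := by
  simp only [Matrix.inv_def, Ring.inverse_eq_inv']
  have hsmul : Continuous fun q : ℝ × Matrix (Fin k) (Fin k) ℝ => q.1 • q.2 := by fun_prop
  have hadj : Continuous fun S : Matrix (Fin k) (Fin k) ℝ => S.adjugate := by fun_prop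
  exact hsmul.measurable.comp ((measurable_matrix_det k).inv.prodMk hadj.measurable)

/-- The positions on or above the diagonal, which index the coordinates of a symmetric matrix. -/
abbrev UpperIndex (k : ℕ) : Type := {q : Fin k × Fin k // q.1 ≤ q.2}

lemma measurable_symMatrix (k : ℕ) : Measurable (symMatrix (k := k)) :=
  measurable_pi_iff.2 fun _ => measurable_pi_iff.2 fun _ => measurable_pi_apply _

lemma isSymm_symMatrix {k : ℕ} (u : UpperIndex k → ℝ) : (symMatrix u).IsSymm := by
  ext i j
  simp [symMatrix, min_comm, max_comm]

/-- Lebesgue measure on positive definite matrices: the second factor of `refMeasure k`. -/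
def posDefVolume (k : ℕ) : Measure (Matrix (Fin k) (Fin k) ℝ) :=
  ((volume : Measure (UpperIndex k → ℝ)).map symMatrix).restrict {S | S.PosDef}

lemma lintegral_posDefVolume {k : ℕ} {F : Matrix (Fin k) (Fin k) ℝ → ℝ≥0∞} (hF : Measurable F) :
    ∫⁻ S, F S ∂posDefVolume k =
      ∫⁻ u : UpperIndex k → ℝ, {S | S.PosDef}.indicator F (symMatrix u) := by
  rw [posDefVolume, ← lintegral_indicator (measurableSet_posDef k),
    lintegral_map (hF.indicator (measurableSet_posDef k)) (measurable_symMatrix k)]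

lemma ae_posDef_posDefVolume (k : ℕ) : ∀ᵐ S ∂posDefVolume k, S.PosDef :=
  ae_restrict_mem (measurableSet_posDef k)

/-! ### Schur coordinates on positive definite matrices -/

/-- The index splitting behind `bordered`: a position on or above the diagonal lies in the lower
right block or in the first row. -/
def upperIndexEquiv (k : ℕ) : UpperIndex k ⊕ Fin (k + 1) ≃ UpperIndex (k + 1) :=
  Equiv.ofBijective
    (Sum.elim (fun q => ⟨(q.1.1.succ, q.1.2.succ), Fin.succ_le_succ_iff.2 q.2⟩)
      fun j => ⟨(0, j), Fin.zero_le j⟩) <| by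
    constructor
    · rintro (⟨⟨i, j⟩, h⟩ | j) (⟨⟨i', j'⟩, h'⟩ | j') hq
      · simpa using hq
      · simp at hq
      · simp [(Fin.succ_ne_zero _).symm] at hq
      · simpa using hq
    · rintro ⟨⟨i, j⟩, h⟩
      cases i using Fin.cases with
      | zero => exact ⟨Sum.inr j, rfl⟩
      | succ i =>
        cases j using Fin.cases with
        | zero => exact absurd h (by simp)
        | succ j => exact ⟨Sum.inl ⟨(i, j), Fin.succ_le_succ_iff.1 h⟩, rfl⟩

@[simp] lemma upperIndexEquiv_inr {k : ℕ} (j : Fin (k + 1)) :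
    upperIndexEquiv k (Sum.inr j) = ⟨(0, j), Fin.zero_le j⟩ := rfl

lemma symMatrix_succ {k : ℕ} (u : UpperIndex (k + 1) → ℝ) :
    symMatrix u = bordered (u (upperIndexEquiv k (Sum.inr 0)))
      (fun j => u (upperIndexEquiv k (Sum.inr j.succ)))
      (fun j => u (upperIndexEquiv k (Sum.inr j.succ)))
      (symMatrix fun q => u (upperIndexEquiv k (Sum.inl q))) := by
  ext i j
  cases i using Fin.cases <;> cases j using Fin.cases
  case succ.succ i j =>
    exact congrArg u (Subtype.ext (Prod.ext (Fin.strictMono_succ.monotone.map_min).symm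
      (Fin.strictMono_succ.monotone.map_max).symm))
  all_goals simp [symMatrix]

lemma measurable_bordered {k : ℕ} :
    Measurable fun q : Matrix (Fin k) (Fin k) ℝ × (Fin k → ℝ) × ℝ =>
      bordered q.2.2 q.2.1 q.2.1 q.1 := by
  refine measurable_pi_iff.2 fun i => measurable_pi_iff.2 fun j => ?_
  cases i using Fin.cases with
  | zero =>
    cases j using Fin.cases with
    | zero => exact measurable_snd.snd
    | succ j => exact (measurable_pi_apply j).comp measurable_snd.fst
  | succ i =>
    cases j using Fin.cases with
    | zero => exact (measurable_pi_apply i).comp measurable_snd.fst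
    | succ j => exact (measurable_pi_apply j).comp ((measurable_pi_apply i).comp measurable_fst)

lemma measurable_schurMatrix {k : ℕ} :
    Measurable fun q : (Matrix (Fin k) (Fin k) ℝ × (Fin k → ℝ)) × ℝ =>
      schurMatrix q.2 q.1.2 q.1.1 := by
  have hrow : Continuous fun q : (Matrix (Fin k) (Fin k) ℝ × (Fin k → ℝ)) × ℝ =>
    q.1.1 *ᵥ q.1.2 := by fun_prop
  have hcorner : Continuous fun q : (Matrix (Fin k) (Fin k) ℝ × (Fin k → ℝ)) × ℝ =>
    q.2 + q.1.2 ⬝ᵥ (q.1.1 *ᵥ q.1.2) := by fun_prop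
  exact measurable_bordered.comp
    (measurable_fst.fst.prodMk (hrow.measurable.prodMk hcorner.measurable))

lemma lintegral_symMatrix_succ {k : ℕ} {F : Matrix (Fin (k + 1)) (Fin (k + 1)) ℝ → ℝ≥0∞}
    (hF : Measurable F) :
    ∫⁻ u : UpperIndex (k + 1) → ℝ, F (symMatrix u) =
      ∫⁻ u : UpperIndex k → ℝ, ∫⁻ b : Fin k → ℝ, ∫⁻ c : ℝ, F (bordered c b b (symMatrix u)) := by
  have e₁ := (volume_measurePreserving_piCongrLeft (fun _ => ℝ) (upperIndexEquiv k)).symm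
  have e₂ := volume_measurePreserving_sumPiEquivProdPi (fun _ : UpperIndex k ⊕ Fin (k + 1) => ℝ)
  have e₃ := volume_preserving_piFinSuccAbove (fun _ : Fin (k + 1) => ℝ) 0
  have e := (MeasurePreserving.prod (MeasurePreserving.id volume) e₃).comp (e₂.comp e₁)
  have hB : Measurable fun q : (UpperIndex k → ℝ) × (ℝ × (Fin k → ℝ)) =>
      F (bordered q.2.1 q.2.2 q.2.2 (symMatrix q.1)) :=
    hF.comp (measurable_bordered.comp (((measurable_symMatrix k).comp measurable_fst).prodMk
      (measurable_snd.snd.prodMk measurable_snd.fst)))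
  calc ∫⁻ u : UpperIndex (k + 1) → ℝ, F (symMatrix u)
      = ∫⁻ q : (UpperIndex k → ℝ) × (ℝ × (Fin k → ℝ)),
          F (bordered q.2.1 q.2.2 q.2.2 (symMatrix q.1)) := by
        rw [Measure.volume_eq_prod, ← e.lintegral_comp hB]
        simp only [symMatrix_succ]
        rfl
    _ = _ := by
        rw [Measure.volume_eq_prod, lintegral_prod _ hB.aemeasurable]
        refine lintegral_congr fun u => ?_
        have hBu : Measurable fun q : ℝ × (Fin k → ℝ) =>
          F (bordered q.1 q.2 q.2 (symMatrix u)) := hB.comp measurable_prodMk_left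
        rw [Measure.volume_eq_prod, lintegral_prod_symm _ hBu.aemeasurable]

lemma lintegral_eq_det_mul_lintegral_mulVec {ι : Type*} [Fintype ι] [DecidableEq ι]
    {A : Matrix ι ι ℝ} (hA : A.det ≠ 0) {F : (ι → ℝ) → ℝ≥0∞} (hF : Measurable F) :
    ∫⁻ y, F y = ENNReal.ofReal |A.det| * ∫⁻ y, F (A *ᵥ y) := by
  have hm : Measurable (Matrix.toLin' A) :=
    (show Continuous fun y => A *ᵥ y by fun_prop).measurable
  have hmap : ∫⁻ y, F (A *ᵥ y) = ∫⁻ y, F y ∂(Measure.map (Matrix.toLin' A) volume) :=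
    (lintegral_map hF hm).symm
  rw [hmap, Real.map_matrix_volume_pi_eq_smul_volume_pi hA, lintegral_smul_measure, smul_eq_mul,
    ← mul_assoc, ← ENNReal.ofReal_mul (abs_nonneg _), ← abs_mul, mul_inv_cancel₀ hA]
  simp

lemma lintegral_bordered_eq_lintegral_schurMatrix {k : ℕ} {T : Matrix (Fin k) (Fin k) ℝ}
    (hT : T.PosDef) {F : Matrix (Fin (k + 1)) (Fin (k + 1)) ℝ → ℝ≥0∞} (hF : Measurable F) :
    ∫⁻ b : Fin k → ℝ, ∫⁻ c : ℝ, {S | S.PosDef}.indicator F (bordered c b b T) =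
      ENNReal.ofReal T.det *
        ∫⁻ β : Fin k → ℝ, ∫⁻ s in Set.Ioi (0 : ℝ), F (schurMatrix s β T) := by
  have hB : Measurable fun q : (Fin k → ℝ) × ℝ =>
      {S | S.PosDef}.indicator F (bordered q.2 q.1 q.1 T) :=
    (hF.indicator (measurableSet_posDef (k + 1))).comp
      (measurable_bordered.comp (measurable_const.prodMk measurable_id))
  rw [lintegral_eq_det_mul_lintegral_mulVec hT.det_pos.ne' hB.lintegral_prod_right',
    abs_of_pos hT.det_pos]
  congr 1
  refine lintegral_congr fun β => ?_
  rw [← lintegral_add_right_eq_self _ (β ⬝ᵥ (T *ᵥ β)), ← lintegral_indicator measurableSet_Ioi]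
  refine lintegral_congr fun s => Set.indicator_eq_indicator ?_ rfl
  change (schurMatrix s β T).PosDef ↔ 0 < s
  simp [posDef_schurMatrix_iff (isHermitian_iff_isSymm.1 hT.1), hT]

lemma lintegral_posDefVolume_succ {k : ℕ} {F : Matrix (Fin (k + 1)) (Fin (k + 1)) ℝ → ℝ≥0∞}
    (hF : Measurable F) :
    ∫⁻ S, F S ∂posDefVolume (k + 1) =
      ∫⁻ T, (ENNReal.ofReal T.det * ∫⁻ β : Fin k → ℝ, ∫⁻ s in Set.Ioi (0 : ℝ),
        F (schurMatrix s β T)) ∂posDefVolume k := by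
  have hI : Measurable fun T : Matrix (Fin k) (Fin k) ℝ => ENNReal.ofReal T.det *
      ∫⁻ β : Fin k → ℝ, ∫⁻ s in Set.Ioi (0 : ℝ), F (schurMatrix s β T) :=
    (measurable_matrix_det k).ennreal_ofReal.mul
      (hF.comp measurable_schurMatrix).lintegral_prod_right'.lintegral_prod_right'
  rw [lintegral_posDefVolume hF,
    lintegral_symMatrix_succ (hF.indicator (measurableSet_posDef (k + 1))),
    lintegral_posDefVolume hI]
  refine lintegral_congr fun u => ?_
  by_cases hu : (symMatrix u).PosDef
  · rw [Set.indicator_of_mem (by exact hu), lintegral_bordered_eq_lintegral_schurMatrix hu hF]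
  · have hzero (b : Fin k → ℝ) (c : ℝ) :
        {S | S.PosDef}.indicator F (bordered c b b (symMatrix u)) = 0 :=
      Set.indicator_of_notMem (by exact fun h => hu (posDef_of_posDef_bordered h)) _
    rw [Set.indicator_of_notMem (by exact hu)]
    simp [hzero]

/-! ### The congruence action on positive definite matrices -/

/-- The linear map `T ↦ A T Aᵀ` on symmetric matrices, in the coordinates on and above the
diagonal. -/
def congrMap {k : ℕ} (A : Matrix (Fin k) (Fin k) ℝ) :
    (UpperIndex k → ℝ) →ₗ[ℝ] (UpperIndex k → ℝ) where
  toFun u := fun q => (A * symMatrix u * Aᵀ) q.1.1 q.1.2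
  map_add' u w := by
    have hadd : symMatrix (u + w) = symMatrix u + symMatrix w := rfl
    ext q
    simp [hadd, Matrix.mul_add, Matrix.add_mul]
  map_smul' a u := by
    have hsmul : symMatrix (a • u) = a • symMatrix u := rfl
    ext q
    simp [hsmul]

lemma congrMap_apply {k : ℕ} (A : Matrix (Fin k) (Fin k) ℝ) (u : UpperIndex k → ℝ)
    (q : UpperIndex k) : congrMap A u q = (A * symMatrix u * Aᵀ) q.1.1 q.1.2 := rfl

lemma symMatrix_congrMap {k : ℕ} (A : Matrix (Fin k) (Fin k) ℝ) (u : UpperIndex k → ℝ) :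
    symMatrix (congrMap A u) = A * symMatrix u * Aᵀ := by
  have hsymm : (A * symMatrix u * Aᵀ).IsSymm := by
    rw [IsSymm, transpose_mul, transpose_mul, transpose_transpose, (isSymm_symMatrix u).eq,
      Matrix.mul_assoc]
  ext i j
  rw [symMatrix, Matrix.of_apply, congrMap_apply]
  rcases le_total i j with h | h
  · simp only [min_eq_left h, max_eq_right h]
  · simp only [min_eq_right h, max_eq_left h]
    exact hsymm.apply _ _

lemma symMatrix_apply_of_le {k : ℕ} (u : UpperIndex k → ℝ) (q : UpperIndex k) :
    symMatrix u q.1.1 q.1.2 = u q := by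
  simp [symMatrix, min_eq_left q.2, max_eq_right q.2]

lemma congrMap_one {k : ℕ} : congrMap (1 : Matrix (Fin k) (Fin k) ℝ) = LinearMap.id := by
  refine LinearMap.ext fun u => funext fun q => ?_
  simp [congrMap_apply, symMatrix_apply_of_le]

lemma det_congrMap_mul {k : ℕ} (A B : Matrix (Fin k) (Fin k) ℝ) :
    LinearMap.det (congrMap (A * B)) = LinearMap.det (congrMap A) * LinearMap.det (congrMap B) := by
  rw [← LinearMap.det_comp]
  congr 1
  refine LinearMap.ext fun u => funext fun q => ?_
  simp only [LinearMap.comp_apply, congrMap_apply, symMatrix_congrMap, transpose_mul,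
    Matrix.mul_assoc]

lemma prod_upperIndex {k : ℕ} (D : Fin k → ℝ) :
    ∏ q : UpperIndex k, D q.1.1 * D q.1.2 = (∏ i, D i) ^ (k + 1) := by
  have hsubtype := Finset.prod_subtype (F := inferInstance)
    (Finset.univ.filter fun q : Fin k × Fin k => q.1 ≤ q.2) (p := fun q => q.1 ≤ q.2) (by simp)
    (fun q => D q.1 * D q.2)
  have hite (i j : Fin k) : (if i ≤ j then D i * D j else 1) =
      (if i ≤ j then D i else 1) * (if i ≤ j then D j else 1) := by
    split_ifs <;> simp
  rw [← hsubtype, Finset.prod_filter, ← Finset.univ_product_univ, Finset.prod_product]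
  simp only [hite, Finset.prod_mul_distrib]
  rw [Finset.prod_comm (f := fun i j => if i ≤ j then D j else 1), ← Finset.prod_mul_distrib,
    ← Finset.prod_pow]
  refine Finset.prod_congr rfl fun i _ => ?_
  rw [Finset.prod_ite, Finset.prod_ite]
  simp only [Finset.prod_const, one_pow, mul_one]
  rw [← pow_add, Finset.filter_le_eq_Ici, Finset.filter_ge_eq_Iic, Fin.card_Ici, Fin.card_Iic]
  congr 1
  omega

lemma det_congrMap_diagonal {k : ℕ} (D : Fin k → ℝ) :
    LinearMap.det (congrMap (diagonal D)) = (diagonal D).det ^ (k + 1) := by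
  have htoLin : congrMap (diagonal D) =
      Matrix.toLin' (diagonal fun q : UpperIndex k => D q.1.1 * D q.1.2) := by
    refine LinearMap.ext fun u => funext fun q => ?_
    rw [congrMap_apply, Matrix.toLin'_apply, mulVec_diagonal, diagonal_transpose,
      Matrix.mul_diagonal, Matrix.diagonal_mul, symMatrix_apply_of_le]
    ring
  rw [htoLin, LinearMap.det_toLin', det_diagonal, det_diagonal, prod_upperIndex]

lemma diagonal_mul_transvection {ι K : Type*} [Fintype ι] [DecidableEq ι] [Field K] (D : ι → K)
    {i j : ι} (hj : D j ≠ 0) (a : K) :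
    diagonal D * transvection i j a = transvection i j (D i * a / D j) * diagonal D := by
  rw [transvection, transvection, mul_add, add_mul, mul_one, one_mul]
  congr 1
  ext l m
  rw [Matrix.diagonal_mul, Matrix.mul_diagonal, single_apply, single_apply]
  split_ifs with h
  · rw [← h.1, ← h.2, div_mul_cancel₀ _ hj]
  · simp

-- `a ↦ det (congrMap (transvection i j a))` is a homomorphism on `ℝ`, and it is unchanged under
-- `a ↦ 2 * a`, which is conjugation by a diagonal matrix.
lemma det_congrMap_transvection {k : ℕ} {i j : Fin k} (hij : i ≠ j) (a : ℝ) :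
    LinearMap.det (congrMap (transvection i j a)) = 1 := by
  set D : Fin k → ℝ := fun l => if l = i then 2 else 1 with hD
  have hDdet : (diagonal D).det ≠ 0 := by
    rw [det_diagonal, Finset.prod_ne_zero_iff]
    intro l _
    simp only [hD]
    split_ifs <;> norm_num
  have hconj : diagonal D * transvection i j a = transvection i j (2 * a) * diagonal D := by
    rw [diagonal_mul_transvection D (by simp [hD, hij.symm])]
    simp [hD, hij.symm]
  have hdouble : LinearMap.det (congrMap (transvection i j (2 * a))) =
      LinearMap.det (congrMap (transvection i j a)) *
        LinearMap.det (congrMap (transvection i j a)) := by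
    rw [two_mul, ← transvection_mul_transvection_same _ _ hij, det_congrMap_mul]
  have hne : LinearMap.det (congrMap (transvection i j a)) ≠ 0 := by
    refine left_ne_zero_of_mul_eq_one (b := LinearMap.det (congrMap (transvection i j (-a)))) ?_
    rw [← det_congrMap_mul, transvection_mul_transvection_same _ _ hij, add_neg_cancel,
      transvection_zero, congrMap_one, LinearMap.det_id]
  have hdet := congrArg (fun M => LinearMap.det (congrMap M)) hconj
  simp only [det_congrMap_mul, det_congrMap_diagonal] at hdet
  rw [hdouble, mul_comm] at hdet
  exact (mul_eq_left₀ hne).1 (mul_right_cancel₀ (pow_ne_zero _ hDdet) hdet).symm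

lemma det_congrMap {k : ℕ} {A : Matrix (Fin k) (Fin k) ℝ} (hA : A.det ≠ 0) :
    LinearMap.det (congrMap A) = A.det ^ (k + 1) := by
  refine diagonal_transvection_induction_of_det_ne_zero
    (fun A => LinearMap.det (congrMap A) = A.det ^ (k + 1)) A hA
    (fun D _ => det_congrMap_diagonal D) (fun t => ?_) (fun A B _ _ hA hB => ?_)
  · rw [TransvectionStruct.toMatrix, det_congrMap_transvection t.hij,
      det_transvection_of_ne _ _ t.hij, one_pow]
  · rw [det_congrMap_mul, hA, hB, det_mul, mul_pow]

lemma posDef_mul_mul_transpose_iff {ι : Type*} [Fintype ι] [DecidableEq ι] {A T : Matrix ι ι ℝ}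
    (hA : A.det ≠ 0) : (A * T * Aᵀ).PosDef ↔ T.PosDef := by
  rw [← conjTranspose_eq_transpose_of_trivial, ← star_eq_conjTranspose]
  exact ((isUnit_iff_isUnit_det A).2 hA.isUnit).posDef_star_right_conjugate_iff

lemma lintegral_posDefVolume_eq_det_mul {k : ℕ} {A : Matrix (Fin k) (Fin k) ℝ} (hA : A.det ≠ 0)
    {F : Matrix (Fin k) (Fin k) ℝ → ℝ≥0∞} (hF : Measurable F) :
    ∫⁻ S, F S ∂posDefVolume k =
      ENNReal.ofReal (|A.det| ^ (k + 1)) * ∫⁻ T, F (A * T * Aᵀ) ∂posDefVolume k := by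
  have hcont : Continuous fun T : Matrix (Fin k) (Fin k) ℝ => A * T * Aᵀ := by fun_prop
  have hdet : LinearMap.det (congrMap A) ≠ 0 := by
    rw [det_congrMap hA]
    exact pow_ne_zero _ hA
  have hind (u : UpperIndex k → ℝ) :
      {S | S.PosDef}.indicator (fun T => F (A * T * Aᵀ)) (symMatrix u) =
        {S | S.PosDef}.indicator F (symMatrix (congrMap A u)) := by
    rw [symMatrix_congrMap]
    exact Set.indicator_eq_indicator (posDef_mul_mul_transpose_iff hA).symm rfl
  rw [lintegral_posDefVolume hF,
    lintegral_posDefVolume (F := fun T => F (A * T * Aᵀ)) (hF.comp hcont.measurable)]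
  simp only [hind]
  rw [← lintegral_map (f := fun u => {S : Matrix (Fin k) (Fin k) ℝ | S.PosDef}.indicator F
      (symMatrix u)) ((hF.indicator (measurableSet_posDef k)).comp (measurable_symMatrix k))
      (LinearMap.continuous_of_finiteDimensional _).measurable,
    Measure.map_linearMap_addHaar_eq_smul_addHaar volume hdet, lintegral_smul_measure, smul_eq_mul,
    ← mul_assoc, det_congrMap hA, ← ENNReal.ofReal_mul (by positivity), ← abs_pow, ← abs_mul,
    mul_inv_cancel₀ (pow_ne_zero _ hA)]
  simp

/-! ### Gaussian and gamma integrals -/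

lemma lintegral_fin_prod_eq_prod {n : ℕ} {E : Fin n → Type*} [∀ i, MeasurableSpace (E i)]
    (μ : ∀ i, Measure (E i)) [∀ i, SigmaFinite (μ i)] {f : ∀ i, E i → ℝ≥0∞}
    (hf : ∀ i, Measurable (f i)) :
    ∫⁻ y, ∏ i, f i (y i) ∂Measure.pi μ = ∏ i, ∫⁻ t, f i t ∂μ i := by
  induction n with
  | zero => simp
  | succ n ih =>
    have htail : Measurable fun y : ∀ i : Fin n, E i.succ => ∏ i, f i.succ (y i) :=
      Finset.measurable_prod _ fun i _ => (hf i.succ).comp (measurable_pi_apply i)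
    rw [← ((measurePreserving_piFinSuccAbove μ 0).symm).lintegral_comp_emb
      (MeasurableEquiv.measurableEmbedding _)]
    simp only [Fin.prod_univ_succ, ← ih (fun i => μ i.succ) fun i => hf i.succ]
    exact lintegral_prod_mul (μ := μ 0) (ν := Measure.pi fun i : Fin n => μ i.succ)
      (hf 0).aemeasurable htail.aemeasurable

lemma pi_withDensity_fin {n : ℕ} {E : Fin n → Type*} [∀ i, MeasurableSpace (E i)]
    (μ : ∀ i, Measure (E i)) [∀ i, SigmaFinite (μ i)] {f : ∀ i, E i → ℝ≥0∞}
    (hf : ∀ i, Measurable (f i)) [∀ i, SigmaFinite ((μ i).withDensity (f i))] :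
    Measure.pi (fun i => (μ i).withDensity (f i)) =
      (Measure.pi μ).withDensity fun y => ∏ i, f i (y i) := by
  refine Measure.pi_eq fun s hs => ?_
  rw [withDensity_apply _ (MeasurableSet.univ_pi hs),
    ← lintegral_indicator (MeasurableSet.univ_pi hs)]
  have hind (y : ∀ i, E i) : (Set.univ.pi s).indicator (fun y => ∏ i, f i (y i)) y =
      ∏ i, (s i).indicator (f i) (y i) := by
    classical
    simp only [Set.indicator_apply, Set.mem_univ_pi, Finset.prod_ite_zero, Finset.mem_univ,
      true_implies]
  simp only [hind, lintegral_fin_prod_eq_prod μ fun i => (hf i).indicator (hs i),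
    lintegral_indicator (hs _), withDensity_apply _ (hs _)]

/-- The standard normal distribution on `ℝᵏ`, with independent coordinates; unlike Mathlib's
`stdGaussian` it lives on `Fin k → ℝ`, where the matrices act. -/
def stdNormal (k : ℕ) : Measure (Fin k → ℝ) := Measure.pi fun _ => gaussianReal 0 1

instance isProbabilityMeasure_stdNormal (k : ℕ) : IsProbabilityMeasure (stdNormal k) :=
  inferInstanceAs (IsProbabilityMeasure (Measure.pi _))

lemma prod_gaussianPDF {k : ℕ} (z : Fin k → ℝ) :
    ∏ i, gaussianPDF 0 1 (z i) =
      ENNReal.ofReal ((2 * Real.pi) ^ (-(k : ℝ) / 2) * Real.exp (-(z ⬝ᵥ z) / 2)) := by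
  simp only [gaussianPDF]
  rw [← ENNReal.ofReal_prod_of_nonneg fun i _ => gaussianPDFReal_nonneg _ _ _]
  simp only [gaussianPDFReal, Finset.prod_mul_distrib, ← Real.exp_sum, Finset.prod_const,
    Finset.card_univ, Fintype.card_fin, NNReal.coe_one, mul_one, sub_zero]
  congr 2
  · rw [Real.sqrt_eq_rpow, ← Real.rpow_neg (by positivity), ← Real.rpow_natCast,
      ← Real.rpow_mul (by positivity)]
    ring_nf
  · simp only [dotProduct, ← Finset.sum_div, Finset.sum_neg_distrib, sq]

lemma measurable_exp_neg_dotProduct_self {k : ℕ} (c : ℝ) :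
    Measurable fun z : Fin k → ℝ => ENNReal.ofReal (Real.exp (-(z ⬝ᵥ z) / c)) :=
  (show Continuous fun z : Fin k → ℝ => Real.exp (-(z ⬝ᵥ z) / c) by
    fun_prop).measurable.ennreal_ofReal

lemma lintegral_stdNormal {k : ℕ} {F : (Fin k → ℝ) → ℝ≥0∞} (hF : Measurable F) :
    ∫⁻ z, F z ∂stdNormal k =
      ENNReal.ofReal ((2 * Real.pi) ^ (-(k : ℝ) / 2)) *
        ∫⁻ z, ENNReal.ofReal (Real.exp (-(z ⬝ᵥ z) / 2)) * F z := by
  have hdensity : stdNormal k = volume.withDensity fun z : Fin k → ℝ => ENNReal.ofReal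
      ((2 * Real.pi) ^ (-(k : ℝ) / 2) * Real.exp (-(z ⬝ᵥ z) / 2)) := by
    have hpdf : gaussianReal 0 1 = volume.withDensity (gaussianPDF 0 1) :=
      gaussianReal_of_var_ne_zero _ one_ne_zero
    have : SigmaFinite (volume.withDensity (gaussianPDF 0 1)) := hpdf ▸ inferInstance
    simp only [stdNormal, hpdf, pi_withDensity_fin (fun _ : Fin k => (volume : Measure ℝ))
      fun _ => measurable_gaussianPDF 0 1, prod_gaussianPDF, volume_pi]
  have hexp := measurable_exp_neg_dotProduct_self (k := k) 2
  simp only [ENNReal.ofReal_mul (show (0 : ℝ) ≤ (2 * Real.pi) ^ (-(k : ℝ) / 2) by positivity)]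
    at hdensity
  rw [hdensity, lintegral_withDensity_eq_lintegral_mul _ (hexp.const_mul _) hF,
    ← lintegral_const_mul _ (hexp.fun_mul hF)]
  simp only [Pi.mul_apply, mul_assoc]

lemma lintegral_exp_neg_dotProduct_self_mul {k : ℕ} {a : ℝ} (ha : a ≠ 0)
    {F : (Fin k → ℝ) → ℝ≥0∞} (hF : Measurable F) :
    ∫⁻ y, ENNReal.ofReal (Real.exp (-(y ⬝ᵥ y) / (2 * a ^ 2))) * F y =
      ENNReal.ofReal ((2 * Real.pi * a ^ 2) ^ ((k : ℝ) / 2)) *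
        ∫⁻ z, F (a • z) ∂stdNormal k := by
  have hdet : (a • (1 : Matrix (Fin k) (Fin k) ℝ)).det = a ^ k := by simp
  have hexponent (z : Fin k → ℝ) : -(a • z ⬝ᵥ a • z) / (2 * a ^ 2) = -(z ⬝ᵥ z) / 2 := by
    rw [smul_dotProduct, dotProduct_smul, smul_eq_mul, smul_eq_mul]
    field_simp
  have hconst : (2 * Real.pi * a ^ 2) ^ ((k : ℝ) / 2) * (2 * Real.pi) ^ (-(k : ℝ) / 2) =
      |a ^ k| := by
    rw [Real.mul_rpow (by positivity) (by positivity), mul_right_comm,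
      ← Real.rpow_add (by positivity), ← add_div, add_neg_cancel, zero_div, Real.rpow_zero,
      one_mul, abs_pow, ← sq_abs, ← Real.rpow_natCast_mul (abs_nonneg a), ← Real.rpow_natCast]
    congr 1
    push_cast
    ring
  rw [lintegral_eq_det_mul_lintegral_mulVec (hdet ▸ pow_ne_zero k ha)
      ((measurable_exp_neg_dotProduct_self _).fun_mul hF),
    lintegral_stdNormal (hF.fun_comp (measurable_const_smul a)), ← mul_assoc,
    ← ENNReal.ofReal_mul (by positivity), hconst, hdet]
  simp only [smul_mulVec, one_mulVec, hexponent]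

lemma charFun_map_mulVec_stdNormal {p k : ℕ} (B : Matrix (Fin p) (Fin k) ℝ)
    (t : EuclideanSpace ℝ (Fin p)) :
    charFun ((stdNormal k).map fun z => WithLp.toLp 2 (B *ᵥ z)) t =
      Complex.exp (-((t.ofLp ⬝ᵥ ((B * Bᵀ) *ᵥ t.ofLp) : ℝ) : ℂ) / 2) := by
  have hB : Measurable fun z : Fin k → ℝ => WithLp.toLp 2 (B *ᵥ z) :=
    (show Continuous fun z : Fin k → ℝ => WithLp.toLp 2 (B *ᵥ z) by fun_prop).measurable
  have hstd := charFun_stdGaussian (E := EuclideanSpace ℝ (Fin k)) (WithLp.toLp 2 (Bᵀ *ᵥ t.ofLp))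
  have hnorm : ‖(WithLp.toLp 2 (Bᵀ *ᵥ t.ofLp) : EuclideanSpace ℝ (Fin k))‖ ^ 2 =
      t.ofLp ⬝ᵥ ((B * Bᵀ) *ᵥ t.ofLp) := by
    rw [EuclideanSpace.real_norm_sq_eq, ← mulVec_mulVec, dotProduct_mulVec, ← mulVec_transpose,
      dotProduct]
    simp only [sq]
  rw [← map_pi_eq_stdGaussian, charFun_apply, integral_map (by fun_prop)
    (Measurable.aestronglyMeasurable (by fun_prop)), ← Complex.ofReal_pow, hnorm] at hstd
  rw [charFun_apply, integral_map hB.aemeasurable (Measurable.aestronglyMeasurable (by fun_prop)),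
    ← hstd]
  refine integral_congr_ae (Filter.Eventually.of_forall fun z => ?_)
  simp only [EuclideanSpace.inner_eq_star_dotProduct, star_trivial, dotProduct_mulVec,
    ← mulVec_transpose]

lemma lintegral_mulVec_stdNormal_congr {p k l : ℕ} {B : Matrix (Fin p) (Fin k) ℝ}
    {B' : Matrix (Fin p) (Fin l) ℝ} (h : B * Bᵀ = B' * B'ᵀ)
    {F : (Fin p → ℝ) → ℝ≥0∞} (hF : Measurable F) :
    ∫⁻ z, F (B *ᵥ z) ∂stdNormal k = ∫⁻ z, F (B' *ᵥ z) ∂stdNormal l := by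
  have hmeas {m : ℕ} (M : Matrix (Fin p) (Fin m) ℝ) :
      Measurable fun z : Fin m → ℝ => WithLp.toLp 2 (M *ᵥ z) :=
    (show Continuous fun z => WithLp.toLp 2 (M *ᵥ z) by fun_prop).measurable
  have hlaw : (stdNormal k).map (fun z => WithLp.toLp 2 (B *ᵥ z)) =
      (stdNormal l).map fun z => WithLp.toLp 2 (B' *ᵥ z) := by
    refine Measure.ext_of_charFun (funext fun t => ?_)
    rw [charFun_map_mulVec_stdNormal, charFun_map_mulVec_stdNormal, h]
  have hF' : Measurable fun y : EuclideanSpace ℝ (Fin p) => F y.ofLp := hF.comp (by fun_prop)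
  simpa only [lintegral_map hF' (hmeas _)] using congrArg (fun m => ∫⁻ y, F y.ofLp ∂m) hlaw

lemma map_ofLp_multivariateGaussian_zero_one (p : ℕ) :
    (multivariateGaussian (0 : EuclideanSpace ℝ (Fin p)) 1).map WithLp.ofLp = stdNormal p := by
  rw [multivariateGaussian_zero_one, ← map_pi_eq_stdGaussian,
    Measure.map_map (by fun_prop) (by fun_prop)]
  exact Measure.map_id

lemma lintegral_rpow_mul_exp_neg_mul {a r : ℝ} (ha : 0 < a) (hr : 0 < r) {G : ℝ → ℝ≥0∞}
    (hG : Measurable G) :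
    ∫⁻ η in Set.Ioi (0 : ℝ), ENNReal.ofReal (η ^ (a - 1) * Real.exp (-(r * η))) * G η =
      ENNReal.ofReal (Real.Gamma a * r ^ (-a)) * ∫⁻ η, G η ∂gammaMeasure a r := by
  have hpdf : Measurable (gammaPDF a r) := (measurable_gammaPDFReal a r).ennreal_ofReal
  have hsupport : Function.support (gammaPDF a r * G) ⊆ Set.Ici 0 := fun η hη => by
    contrapose! hη
    simp [gammaPDF_of_neg (not_le.1 hη)]
  rw [gammaMeasure, lintegral_withDensity_eq_lintegral_mul _ hpdf hG,
    ← setLIntegral_eq_of_support_subset hsupport, setLIntegral_congr Ioi_ae_eq_Ici.symm,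
    ← lintegral_const_mul _ (hpdf.mul hG)]
  refine setLIntegral_congr_fun measurableSet_Ioi fun η (hη : 0 < η) => ?_
  rw [Pi.mul_apply, gammaPDF_of_nonneg hη.le, ← mul_assoc, ← ENNReal.ofReal_mul (by positivity),
    Real.rpow_neg hr.le]
  congr 2
  field_simp

lemma isProbabilityMeasure_chiSquared {ν : ℝ} (hν : 0 < ν) :
    IsProbabilityMeasure (chiSquared ν) :=
  isProbabilityMeasure_gammaMeasure (half_pos hν) (by norm_num)

lemma lintegral_Ioi_inv (g : ℝ → ℝ≥0∞) :
    ∫⁻ s in Set.Ioi (0 : ℝ), g s =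
      ∫⁻ η in Set.Ioi (0 : ℝ), ENNReal.ofReal ((η ^ 2)⁻¹) * g η⁻¹ := by
  have h := lintegral_image_eq_lintegral_abs_deriv_mul (s := Set.Ioi (0 : ℝ))
    (f := fun η => η⁻¹) (f' := fun η => -(η ^ 2)⁻¹) measurableSet_Ioi
    (fun η hη => (hasDerivAt_inv (ne_of_gt hη)).hasDerivWithinAt) inv_injective.injOn g
  have hinv : (Set.Ioi (0 : ℝ))⁻¹ = Set.Ioi 0 := Set.ext fun s => by simp
  simpa [hinv] using h

/-! ### The inverse Wishart kernel with identity scale -/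

/-- The unnormalized inverse Wishart density with `ν` degrees of freedom and scale matrix `S`. The
distribution `IW_k(d, S)` of the conjugate prior has `ν = d - k - 1`. -/
def invWishartKernel {k : ℕ} (ν : ℝ) (S T : Matrix (Fin k) (Fin k) ℝ) : ℝ :=
  T.det ^ (-(ν + k + 1) / 2) * Real.exp (-(T⁻¹ * S).trace / 2)

/-- The total mass of the inverse Wishart kernel with identity scale matrix. -/
def invWishartMass (k : ℕ) (ν : ℝ) : ℝ≥0∞ :=
  ∫⁻ T, ENNReal.ofReal (invWishartKernel ν (1 : Matrix (Fin k) (Fin k) ℝ) T) ∂posDefVolume k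

/-- The factor of the inverse Wishart kernel of `schurMatrix s β T` which involves the Schur
complement `s` and the regression coefficients `β ∈ ℝᵏ`. -/
def schurKernel {k : ℕ} (ν s : ℝ) (β : Fin k → ℝ) : ℝ :=
  s ^ (-(ν + k + 2) / 2) * Real.exp (-(s⁻¹ * (1 + β ⬝ᵥ β)) / 2)

/-- The total mass of `schurKernel`. -/
def schurMass (k : ℕ) (ν : ℝ) : ℝ :=
  Real.Gamma (ν / 2) * (1 / 2) ^ (-(ν / 2)) * (2 * Real.pi) ^ ((k : ℝ) / 2)

lemma schurMass_pos (k : ℕ) {ν : ℝ} (hν : 0 < ν) : 0 < schurMass k ν := by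
  unfold schurMass
  positivity

lemma measurable_invWishartKernel {k : ℕ} (ν : ℝ) (S : Matrix (Fin k) (Fin k) ℝ) :
    Measurable (invWishartKernel ν S) := by
  have htrace : Measurable fun T : Matrix (Fin k) (Fin k) ℝ => (T * S).trace :=
    Continuous.measurable (by fun_prop)
  exact ((measurable_matrix_det k).pow_const _).mul
    ((htrace.comp (measurable_matrix_inv k)).neg.div_const 2).exp

lemma measurable_inv_mulVec {k : ℕ} (v : Fin k → ℝ) :
    Measurable fun T : Matrix (Fin k) (Fin k) ℝ => T⁻¹ *ᵥ v :=
  (show Continuous fun T : Matrix (Fin k) (Fin k) ℝ => T *ᵥ v by fun_prop).measurable.comp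
    (measurable_matrix_inv k)

lemma measurable_cons {k : ℕ} {α : Type*} [MeasurableSpace α] {f : α → ℝ} {g : α → Fin k → ℝ}
    (hf : Measurable f) (hg : Measurable g) :
    Measurable fun a => (Fin.cons (f a) (g a) : Fin (k + 1) → ℝ) :=
  measurable_pi_iff.2 <| Fin.cases hf fun i => (measurable_pi_apply i).comp hg

lemma measurable_schurKernel_mul {k : ℕ} (ν : ℝ) {F : (Fin (k + 1) → ℝ) → ℝ≥0∞}
    (hF : Measurable F) :
    Measurable fun q : (Fin k → ℝ) × ℝ => ENNReal.ofReal (schurKernel ν q.2 q.1) *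
      F (q.2⁻¹ • (Fin.cons 1 (-q.1) : Fin (k + 1) → ℝ)) := by
  have hdot : Measurable fun q : (Fin k → ℝ) × ℝ => q.1 ⬝ᵥ q.1 :=
    (show Continuous fun q : (Fin k → ℝ) × ℝ => q.1 ⬝ᵥ q.1 by fun_prop).measurable
  unfold schurKernel
  exact (Measurable.ennreal_ofReal (by fun_prop)).mul
    (hF.comp (measurable_snd.inv.smul (measurable_cons measurable_const measurable_fst.neg)))

lemma invWishartKernel_schurMatrix {k : ℕ} (ν : ℝ) {s : ℝ} (hs : 0 < s) (β : Fin k → ℝ)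
    {T : Matrix (Fin k) (Fin k) ℝ} (hT : T.PosDef) :
    T.det * invWishartKernel ν 1 (schurMatrix s β T) =
      invWishartKernel (ν - 1) 1 T * schurKernel ν s β := by
  have hsymm : T.IsSymm := isHermitian_iff_isSymm.1 hT.1
  have hdet := hT.det_pos
  have hpow : T.det * T.det ^ (-(ν + k + 2) / 2) = T.det ^ (-(ν - 1 + k + 1) / 2) := by
    nth_rewrite 1 [← Real.rpow_one T.det]
    rw [← Real.rpow_add hdet]
    ring_nf
  have hexp : Real.exp (-(T⁻¹.trace + s⁻¹ * (1 + β ⬝ᵥ β)) / 2) =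
      Real.exp (-T⁻¹.trace / 2) * Real.exp (-(s⁻¹ * (1 + β ⬝ᵥ β)) / 2) := by
    rw [← Real.exp_add]
    ring_nf
  have hcast : ν + ((k + 1 : ℕ) : ℝ) + 1 = ν + k + 2 := by push_cast; ring
  simp only [invWishartKernel, schurKernel, mul_one, hcast,
    trace_schurMatrix_inv hs.ne' hsymm hdet.ne'.isUnit, det_schurMatrix hsymm, hexp,
    Real.mul_rpow hs.le hdet.le, ← hpow]
  ring

lemma schurKernel_inv {k : ℕ} (ν : ℝ) {η : ℝ} (hη : 0 < η) (β : Fin k → ℝ) :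
    schurKernel ν η⁻¹ β = η ^ ((ν + k + 2) / 2) * Real.exp (-(1 / 2 * η)) *
      Real.exp (-(β ⬝ᵥ β) / (2 * (-(√η)⁻¹) ^ 2)) := by
  have hvar : (-(√η)⁻¹) ^ 2 = η⁻¹ := by rw [neg_sq, inv_pow, Real.sq_sqrt hη.le]
  rw [schurKernel, Real.inv_rpow hη.le, ← Real.rpow_neg hη.le, inv_inv, hvar, mul_assoc,
    ← Real.exp_add]
  congr 2
  · ring
  · field_simp
    ring

lemma lintegral_schurKernel_inv {k : ℕ} (ν : ℝ) {η : ℝ} (hη : 0 < η)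
    {F : (Fin (k + 1) → ℝ) → ℝ≥0∞} (hF : Measurable F) :
    ∫⁻ β : Fin k → ℝ, ENNReal.ofReal (schurKernel ν η⁻¹ β) *
        F (η⁻¹⁻¹ • (Fin.cons 1 (-β) : Fin (k + 1) → ℝ)) =
      ENNReal.ofReal (η ^ ((ν + 2) / 2) * Real.exp (-(1 / 2 * η)) *
          (2 * Real.pi) ^ ((k : ℝ) / 2)) *
        ∫⁻ z, F (Fin.cons η (√η • z)) ∂stdNormal k := by
  have hsqrt : 0 < √η := Real.sqrt_pos.2 hη
  have hvec (z : Fin k → ℝ) : η • (Fin.cons 1 (-(-(√η)⁻¹ • z)) : Fin (k + 1) → ℝ) =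
      Fin.cons η (√η • z) := by
    ext i
    cases i using Fin.cases with
    | zero => simp
    | succ i =>
      have hdiv : η * (√η)⁻¹ = √η := by rw [← div_eq_mul_inv, Real.div_sqrt]
      simp [← mul_assoc, hdiv]
  have hvar : (-(√η)⁻¹) ^ 2 = η⁻¹ := by rw [neg_sq, inv_pow, Real.sq_sqrt hη.le]
  have hconst : η ^ ((ν + k + 2) / 2) * (2 * Real.pi * η⁻¹) ^ ((k : ℝ) / 2) =
      η ^ ((ν + 2) / 2) * (2 * Real.pi) ^ ((k : ℝ) / 2) := by
    rw [Real.mul_rpow (by positivity) (by positivity), Real.inv_rpow hη.le, ← Real.rpow_neg hη.le,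
      mul_left_comm, ← Real.rpow_add hη, mul_comm]
    ring_nf
  have hFβ : Measurable fun β : Fin k → ℝ => F (η • (Fin.cons 1 (-β) : Fin (k + 1) → ℝ)) :=
    hF.comp ((measurable_cons measurable_const measurable_neg).const_smul η)
  simp only [schurKernel_inv ν hη, inv_inv,
    ENNReal.ofReal_mul (show 0 ≤ η ^ ((ν + k + 2) / 2) * Real.exp (-(1 / 2 * η)) by positivity),
    mul_assoc (ENNReal.ofReal _)]
  rw [lintegral_const_mul' _ _ ENNReal.ofReal_ne_top,
    lintegral_exp_neg_dotProduct_self_mul (by simpa using hsqrt.ne') hFβ, hvar]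
  simp only [hvec]
  rw [← mul_assoc, ← ENNReal.ofReal_mul (by positivity), mul_right_comm, hconst, mul_right_comm]

/-- In terms of `η = 1 / s` and `z = -√η β`, the kernel of `(s, β)` factors into a `χ²` and a
standard normal one. -/
lemma lintegral_schurKernel {k : ℕ} {ν : ℝ} (hν : 0 < ν) {F : (Fin (k + 1) → ℝ) → ℝ≥0∞}
    (hF : Measurable F) :
    ∫⁻ β : Fin k → ℝ, ∫⁻ s in Set.Ioi (0 : ℝ), ENNReal.ofReal (schurKernel ν s β) *
        F (s⁻¹ • (Fin.cons 1 (-β) : Fin (k + 1) → ℝ)) =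
      ENNReal.ofReal (schurMass k ν) *
        ∫⁻ η, ∫⁻ z, F (Fin.cons η (√η • z)) ∂stdNormal k ∂chiSquared ν := by
  have hcons : Measurable fun q : ℝ × (Fin k → ℝ) => F (Fin.cons q.1 (√q.1 • q.2)) :=
    hF.comp (measurable_cons measurable_fst (measurable_fst.sqrt.smul measurable_snd))
  rw [lintegral_lintegral_swap (measurable_schurKernel_mul ν hF).aemeasurable, lintegral_Ioi_inv,
    schurMass, mul_comm (Real.Gamma _ * _), ENNReal.ofReal_mul (by positivity), mul_assoc,
    chiSquared, ← lintegral_rpow_mul_exp_neg_mul (half_pos hν) one_half_pos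
      hcons.lintegral_prod_right', ← lintegral_const_mul' _ _ ENNReal.ofReal_ne_top]
  refine setLIntegral_congr_fun measurableSet_Ioi fun η (hη : 0 < η) => ?_
  have hpow : (η ^ 2)⁻¹ * η ^ ((ν + 2) / 2) = η ^ (ν / 2 - 1) := by
    rw [← Real.rpow_natCast, ← Real.rpow_neg hη.le, ← Real.rpow_add hη]
    ring_nf
  dsimp only
  rw [lintegral_schurKernel_inv ν hη hF, ← mul_assoc, ← mul_assoc,
    ← ENNReal.ofReal_mul (by positivity), ← ENNReal.ofReal_mul (by positivity), ← hpow]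
  ring_nf

lemma lintegral_invWishartKernel_one_succ {k : ℕ} {ν : ℝ} (hν : 0 < ν)
    {F : (Fin (k + 1) → ℝ) → ℝ≥0∞} (hF : Measurable F) :
    ∫⁻ T, ENNReal.ofReal (invWishartKernel ν 1 T) * F (T⁻¹ *ᵥ Pi.single 0 1)
        ∂posDefVolume (k + 1) =
      invWishartMass k (ν - 1) * (ENNReal.ofReal (schurMass k ν) *
        ∫⁻ η, ∫⁻ z, F (Fin.cons η (√η • z)) ∂stdNormal k ∂chiSquared ν) := by
  rw [lintegral_posDefVolume_succ ((measurable_invWishartKernel ν 1).ennreal_ofReal.fun_mul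
      (hF.fun_comp (measurable_inv_mulVec _))), ← lintegral_schurKernel hν hF, invWishartMass,
    ← lintegral_mul_const _ (measurable_invWishartKernel _ 1).ennreal_ofReal]
  refine lintegral_congr_ae ((ae_posDef_posDefVolume k).mono fun T hT => ?_)
  have hsymm : T.IsSymm := isHermitian_iff_isSymm.1 hT.1
  have hdet := hT.det_pos
  have hkernel : 0 ≤ invWishartKernel (ν - 1) 1 T := by
    unfold invWishartKernel
    positivity
  dsimp only
  simp only [← lintegral_const_mul' _ _ ENNReal.ofReal_ne_top]
  refine lintegral_congr fun β => setLIntegral_congr_fun measurableSet_Ioi fun s (hs : 0 < s) => ?_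
  rw [schurMatrix_inv_mulVec_single hs.ne' hsymm hdet.ne'.isUnit, ← mul_assoc, ← mul_assoc,
    ← ENNReal.ofReal_mul hdet.le, ← ENNReal.ofReal_mul hkernel,
    invWishartKernel_schurMatrix ν hs β hT]

lemma invWishartMass_succ (k : ℕ) {ν : ℝ} (hν : 0 < ν) :
    invWishartMass (k + 1) ν = invWishartMass k (ν - 1) * ENNReal.ofReal (schurMass k ν) := by
  have := isProbabilityMeasure_chiSquared hν
  simpa [invWishartMass] using lintegral_invWishartKernel_one_succ hν (F := 1) measurable_const

lemma lintegral_invWishartKernel_one {k : ℕ} {ν : ℝ} (hν : 0 < ν)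
    {F : (Fin (k + 1) → ℝ) → ℝ≥0∞} (hF : Measurable F) :
    ∫⁻ T, ENNReal.ofReal (invWishartKernel ν 1 T) * F (T⁻¹ *ᵥ Pi.single 0 1)
        ∂posDefVolume (k + 1) =
      invWishartMass (k + 1) ν *
        ∫⁻ η, ∫⁻ z, F (Fin.cons η (√η • z)) ∂stdNormal k ∂chiSquared ν := by
  rw [lintegral_invWishartKernel_one_succ hν hF, invWishartMass_succ k hν, mul_assoc]

lemma invWishartMass_zero (ν : ℝ) : invWishartMass 0 ν = 1 := by
  have hvolume : (volume : Measure (UpperIndex 0 → ℝ)) Set.univ = 1 := by simp [volume_pi]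
  have hposDef (T : Matrix (Fin 0) (Fin 0) ℝ) : T.PosDef :=
    Subsingleton.elim 1 T ▸ Matrix.PosDef.one
  have hmass : posDefVolume 0 Set.univ = 1 := by
    rw [← lintegral_one, lintegral_posDefVolume measurable_const]
    simp [hposDef, hvolume]
  simp [invWishartMass, invWishartKernel, hmass]

lemma invWishartMass_ne_zero_and_ne_top (k : ℕ) {ν : ℝ} (hν : (k : ℝ) - 1 < ν) :
    invWishartMass k ν ≠ 0 ∧ invWishartMass k ν ≠ ∞ := by
  induction k generalizing ν with
  | zero => simp [invWishartMass_zero]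
  | succ k ih =>
    push_cast at hν
    have hpos : 0 < ν := by linarith [k.cast_nonneg (α := ℝ)]
    obtain ⟨hne_zero, hne_top⟩ := ih (ν := ν - 1) (by linarith)
    rw [invWishartMass_succ k hpos]
    exact ⟨mul_ne_zero hne_zero (ENNReal.ofReal_pos.2 (schurMass_pos k hpos)).ne',
      ENNReal.mul_ne_top hne_top ENNReal.ofReal_ne_top⟩

/-! ### The inverse Wishart kernel with general scale -/

/-- The Householder matrix of `u`, the reflection which maps `u` to `-u`. -/
def householder {ι : Type*} [Fintype ι] [DecidableEq ι] (u : ι → ℝ) : Matrix ι ι ℝ :=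
  1 - (2 / (u ⬝ᵥ u)) • vecMulVec u u

section Householder

variable {ι : Type*} [Fintype ι] [DecidableEq ι]

lemma transpose_householder (u : ι → ℝ) : (householder u)ᵀ = householder u := by
  simp [householder, transpose_vecMulVec]

lemma householder_mul_self (u : ι → ℝ) : householder u * householder u = 1 := by
  by_cases hu : u ⬝ᵥ u = 0
  · simp [householder, hu]
  · have hsq : vecMulVec u u * vecMulVec u u = (u ⬝ᵥ u) • vecMulVec u u := by
      rw [vecMulVec_mul_vecMulVec, vecMulVec_smul]
    have hcoeff : 2 / (u ⬝ᵥ u) * (2 / (u ⬝ᵥ u) * (u ⬝ᵥ u)) = 2 / (u ⬝ᵥ u) + 2 / (u ⬝ᵥ u) := by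
      field_simp
      ring
    simp only [householder, sub_mul, mul_sub, one_mul, mul_one, Matrix.smul_mul, Matrix.mul_smul,
      hsq, smul_smul, hcoeff, add_smul]
    abel

lemma householder_sub_mulVec {w e : ι → ℝ} (h : w ⬝ᵥ w = e ⬝ᵥ e) :
    householder (w - e) *ᵥ e = w := by
  obtain rfl | hne := eq_or_ne w e
  · simp [householder]
  · have hu : (w - e) ⬝ᵥ (w - e) ≠ 0 := mt dotProduct_self_eq_zero.1 (sub_ne_zero.2 hne)
    have hnorm : (w - e) ⬝ᵥ (w - e) = -2 * ((w - e) ⬝ᵥ e) := by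
      simp only [sub_dotProduct, dotProduct_sub, h, dotProduct_comm e w]
      ring
    have hcoeff : 2 / ((w - e) ⬝ᵥ (w - e)) * ((w - e) ⬝ᵥ e) = -1 := by
      rw [div_mul_eq_mul_div, div_eq_iff hu, hnorm]
      ring
    rw [householder, sub_mulVec, one_mulVec, smul_mulVec, vecMulVec_mulVec, op_smul_eq_smul,
      smul_smul, hcoeff]
    module

lemma sqrt_mul_transpose_sqrt {Q : Matrix ι ι ℝ} (hQ : Q.PosSemidef) :
    CFC.sqrt Q * (CFC.sqrt Q)ᵀ = Q := by
  rw [isHermitian_iff_isSymm.1 (CFC.sqrt_nonneg Q).posSemidef.isHermitian,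
    CFC.sqrt_mul_sqrt_self Q hQ.nonneg]

lemma det_ne_zero_of_posDef_mul_transpose {A : Matrix ι ι ℝ} (h : (A * Aᵀ).PosDef) :
    A.det ≠ 0 := by
  refine left_ne_zero_of_mul (b := Aᵀ.det) ?_
  rw [← det_mul]
  exact h.det_pos.ne'

lemma exists_mul_transpose_eq_and_smul_mulVec_single_eq {S : Matrix ι ι ℝ} (hS : S.PosDef)
    (v : ι → ℝ) (i : ι) :
    ∃ (A : Matrix ι ι ℝ) (a : ℝ), A * Aᵀ = S ∧ a • (A *ᵥ Pi.single i 1) = v := by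
  set R := CFC.sqrt S
  have hRR : R * Rᵀ = S := sqrt_mul_transpose_sqrt hS.posSemidef
  have hRdet : R.det ≠ 0 := det_ne_zero_of_posDef_mul_transpose (hRR.symm ▸ hS)
  set w := R⁻¹ *ᵥ v
  have hRw : R *ᵥ w = v := by
    rw [mulVec_mulVec, mul_nonsing_inv _ hRdet.isUnit, one_mulVec]
  set a := √(w ⬝ᵥ w)
  set H := householder (w - a • Pi.single i 1)
  have hHw : a • (H *ᵥ Pi.single i 1) = w := by
    rw [← mulVec_smul]
    refine householder_sub_mulVec ?_
    have hnonneg : 0 ≤ w ⬝ᵥ w := Finset.sum_nonneg fun i _ => mul_self_nonneg _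
    simp [a, Real.mul_self_sqrt hnonneg]
  refine ⟨R * H, a, ?_, ?_⟩
  · rw [transpose_mul, transpose_householder, mul_assoc, ← mul_assoc H, householder_mul_self,
      one_mul, hRR]
  · rw [← mulVec_mulVec, ← mulVec_smul, hHw, hRw]

end Householder

lemma invWishartKernel_mul_mul_transpose {k : ℕ} (ν : ℝ) {A T : Matrix (Fin k) (Fin k) ℝ}
    (hA : A.det ≠ 0) (hT : T.PosDef) :
    invWishartKernel ν (A * Aᵀ) (A * T * Aᵀ) =
      |A.det| ^ (-(ν + k + 1)) * invWishartKernel ν 1 T := by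
  have htrace : ((A * T * Aᵀ)⁻¹ * (A * Aᵀ)).trace = T⁻¹.trace := by
    have hAT : Aᵀ * (Aᵀ)⁻¹ = 1 := mul_nonsing_inv _ (by simpa using hA)
    have hAA : A⁻¹ * A = 1 := nonsing_inv_mul _ hA.isUnit
    calc ((A * T * Aᵀ)⁻¹ * (A * Aᵀ)).trace = ((Aᵀ)⁻¹ * (T⁻¹ * (A⁻¹ * A) * Aᵀ)).trace := by
          simp only [Matrix.mul_inv_rev, mul_assoc]
      _ = T⁻¹.trace := by rw [hAA, mul_one, trace_mul_comm, mul_assoc, hAT, mul_one]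
  have hdet : (A * T * Aᵀ).det = |A.det| ^ (2 : ℝ) * T.det := by
    rw [det_mul, det_mul, det_transpose, Real.rpow_two, sq_abs]
    ring
  rw [invWishartKernel, invWishartKernel, htrace, hdet, mul_one,
    Real.mul_rpow (by positivity) hT.det_pos.le, ← Real.rpow_mul (abs_nonneg _), ← mul_assoc]
  ring_nf

lemma lintegral_invWishartKernel_mul_transpose {k : ℕ} (ν : ℝ) {A : Matrix (Fin k) (Fin k) ℝ}
    (hA : A.det ≠ 0) {F : Matrix (Fin k) (Fin k) ℝ → ℝ≥0∞} (hF : Measurable F) :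
    ∫⁻ S, ENNReal.ofReal (invWishartKernel ν (A * Aᵀ) S) * F S ∂posDefVolume k =
      ENNReal.ofReal ((A * Aᵀ).det ^ (-ν / 2)) *
        ∫⁻ T, ENNReal.ofReal (invWishartKernel ν 1 T) * F (A * T * Aᵀ) ∂posDefVolume k := by
  have hpos : 0 < |A.det| := abs_pos.2 hA
  have hpow : |A.det| ^ (k + 1) * |A.det| ^ (-(ν + k + 1)) = (A * Aᵀ).det ^ (-ν / 2) := by
    rw [det_mul, det_transpose, ← abs_mul_abs_self, ← Real.rpow_natCast, ← Real.rpow_add hpos,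
      Real.mul_rpow hpos.le hpos.le, ← Real.rpow_add hpos]
    push_cast
    ring_nf
  rw [lintegral_posDefVolume_eq_det_mul hA
      ((measurable_invWishartKernel ν _).ennreal_ofReal.fun_mul hF), ← hpow,
    ENNReal.ofReal_mul (by positivity), mul_assoc,
    ← lintegral_const_mul' (ENNReal.ofReal (|A.det| ^ (-(ν + k + 1)))) _ ENNReal.ofReal_ne_top]
  congr 1
  refine lintegral_congr_ae ((ae_posDef_posDefVolume k).mono fun T hT => ?_)
  simp only [invWishartKernel_mul_mul_transpose ν hA hT]
  rw [ENNReal.ofReal_mul (by positivity), mul_assoc]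

/-- The dispersion matrix in the stochastic representation of `L Σ⁻¹ v`, where `V` is the inverse
of the scale matrix of `Σ`. -/
def portfolioCov {k p : ℕ} (L : Matrix (Fin p) (Fin k) ℝ) (V : Matrix (Fin k) (Fin k) ℝ)
    (v : Fin k → ℝ) : Matrix (Fin p) (Fin p) ℝ :=
  (v ⬝ᵥ (V *ᵥ v)) • (L * V * Lᵀ) - L * V * vecMulVec v v * V * Lᵀ

lemma mul_transpose_eq_vecMulVec_add {k p : ℕ} (M : Matrix (Fin p) (Fin (k + 1)) ℝ) :
    M * Mᵀ = vecMulVec (M.col 0) (M.col 0) +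
      M.submatrix id Fin.succ * (M.submatrix id Fin.succ)ᵀ := by
  ext i j
  simp [mul_apply, Fin.sum_univ_succ, vecMulVec_apply]

lemma mulVec_cons {k p : ℕ} (M : Matrix (Fin p) (Fin (k + 1)) ℝ) (c : ℝ) (y : Fin k → ℝ) :
    M *ᵥ (Fin.cons c y : Fin (k + 1) → ℝ) = c • M.col 0 + M.submatrix id Fin.succ *ᵥ y := by
  ext i
  simp [mulVec, dotProduct, Fin.sum_univ_succ, mul_comm]

section Factorization

variable {k p : ℕ} {A : Matrix (Fin (k + 1)) (Fin (k + 1)) ℝ} (hA : A.det ≠ 0)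
  (L : Matrix (Fin p) (Fin (k + 1)) ℝ) (a : ℝ)
include hA

lemma mulVec_inv_mul_mul_transpose_mulVec (T : Matrix (Fin (k + 1)) (Fin (k + 1)) ℝ) :
    L *ᵥ ((A * T * Aᵀ)⁻¹ *ᵥ (a • (A *ᵥ Pi.single 0 1))) =
      (a • (L * (Aᵀ)⁻¹)) *ᵥ (T⁻¹ *ᵥ Pi.single 0 1) := by
  have hAA : A⁻¹ * A = 1 := nonsing_inv_mul _ hA.isUnit
  simp only [Matrix.mul_inv_rev, mulVec_smul, mulVec_mulVec, Matrix.smul_mul, smul_mulVec,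
    Matrix.mul_assoc, hAA, mul_one]

lemma mul_inv_mul_transpose_mulVec :
    (L * (A * Aᵀ)⁻¹) *ᵥ (a • (A *ᵥ Pi.single 0 1)) = (a • (L * (Aᵀ)⁻¹)).col 0 := by
  rw [← mulVec_mulVec, ← mulVec_single_one]
  simpa only [mul_one, inv_one, one_mulVec] using mulVec_inv_mul_mul_transpose_mulVec hA L a 1

lemma portfolioCov_mul_transpose_inv :
    portfolioCov L (A * Aᵀ)⁻¹ (a • (A *ᵥ Pi.single 0 1)) =
      (a • (L * (Aᵀ)⁻¹)).submatrix id Fin.succ * ((a • (L * (Aᵀ)⁻¹)).submatrix id Fin.succ)ᵀ := by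
  set V := (A * Aᵀ)⁻¹ with hV
  set v := a • (A *ᵥ Pi.single 0 1) with hv
  set M := a • (L * (Aᵀ)⁻¹) with hM
  have hVT : Vᵀ = V := by
    rw [hV, transpose_nonsing_inv, transpose_mul, transpose_transpose]
  have hquad : v ⬝ᵥ (V *ᵥ v) = a ^ 2 := by
    have hAT : Aᵀ * (Aᵀ)⁻¹ = 1 := mul_nonsing_inv _ (by simpa using hA)
    have hVv : V *ᵥ v = a • ((Aᵀ)⁻¹ *ᵥ Pi.single 0 1) := by
      simpa only [one_mul, ← mulVec_single_one, smul_mulVec]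
        using mul_inv_mul_transpose_mulVec hA (1 : Matrix (Fin (k + 1)) _ ℝ) a
    rw [hVv, hv, smul_dotProduct, dotProduct_smul, ← vecMul_transpose, ← dotProduct_mulVec,
      mulVec_mulVec, hAT]
    simp [sq]
  have hMM : a ^ 2 • (L * V * Lᵀ) = M * Mᵀ := by
    rw [hM, hV, transpose_smul, transpose_mul, transpose_nonsing_inv, transpose_transpose,
      Matrix.mul_inv_rev, Matrix.smul_mul, Matrix.mul_smul, smul_smul, sq]
    simp only [Matrix.mul_assoc]
  have hcol : L * V * vecMulVec v v * V * Lᵀ = vecMulVec (M.col 0) (M.col 0) := by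
    rw [← mul_inv_mul_transpose_mulVec hA L a, mul_vecMulVec, vecMulVec_mul, vecMulVec_mul,
      vecMul_vecMul, ← mulVec_transpose, transpose_mul, transpose_transpose, hVT]
  rw [portfolioCov, hquad, hMM, hcol, mul_transpose_eq_vecMulVec_add, add_sub_cancel_left]

end Factorization

lemma posSemidef_portfolioCov {k p : ℕ} (hk : 0 < k) (L : Matrix (Fin p) (Fin k) ℝ)
    {S : Matrix (Fin k) (Fin k) ℝ} (hS : S.PosDef) (v : Fin k → ℝ) :
    (portfolioCov L S⁻¹ v).PosSemidef := by
  obtain ⟨k, rfl⟩ := Nat.exists_eq_succ_of_ne_zero hk.ne'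
  obtain ⟨A, a, rfl, rfl⟩ := exists_mul_transpose_eq_and_smul_mulVec_single_eq hS v 0
  have hA := det_ne_zero_of_posDef_mul_transpose hS
  rw [portfolioCov_mul_transpose_inv hA]
  exact posSemidef_self_mul_conjTranspose _

lemma lintegral_invWishartKernel {k p : ℕ} (hk : 0 < k) {ν : ℝ} (hν : 0 < ν)
    (L : Matrix (Fin p) (Fin k) ℝ) {S : Matrix (Fin k) (Fin k) ℝ} (hS : S.PosDef) (v : Fin k → ℝ)
    {F : (Fin p → ℝ) → ℝ≥0∞} (hF : Measurable F) :
    ∫⁻ T, ENNReal.ofReal (invWishartKernel ν S T) * F (L *ᵥ (T⁻¹ *ᵥ v)) ∂posDefVolume k =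
      invWishartMass k ν * (ENNReal.ofReal (S.det ^ (-ν / 2)) *
        ∫⁻ η, ∫⁻ z, F (η • ((L * S⁻¹) *ᵥ v) + √η • (CFC.sqrt (portfolioCov L S⁻¹ v) *ᵥ z))
          ∂stdNormal p ∂chiSquared ν) := by
  have hsqrt := sqrt_mul_transpose_sqrt (posSemidef_portfolioCov hk L hS v)
  obtain ⟨k, rfl⟩ := Nat.exists_eq_succ_of_ne_zero hk.ne'
  obtain ⟨A, a, rfl, rfl⟩ := exists_mul_transpose_eq_and_smul_mulVec_single_eq hS v 0
  have hA := det_ne_zero_of_posDef_mul_transpose hS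
  set M := a • (L * (Aᵀ)⁻¹)
  have hFM : Measurable fun u => F (M *ᵥ u) :=
    hF.comp (show Continuous fun u => M *ᵥ u by fun_prop).measurable
  rw [portfolioCov_mul_transpose_inv hA, ← portfolioCov_mul_transpose_inv hA] at hsqrt
  rw [lintegral_invWishartKernel_mul_transpose ν hA (F := fun T => F (L *ᵥ (T⁻¹ *ᵥ _)))
    (hF.comp ((show Continuous fun u => L *ᵥ u by fun_prop).measurable.comp
      (measurable_inv_mulVec _)))]
  simp only [mulVec_inv_mul_mul_transpose_mulVec hA, mul_inv_mul_transpose_mulVec hA]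
  rw [lintegral_invWishartKernel_one hν hFM, mul_left_comm]
  congr 2
  refine lintegral_congr fun η => ?_
  simp only [mulVec_cons, mulVec_smul]
  refine lintegral_mulVec_stdNormal_congr (F := fun y => F (η • M.col 0 + √η • y)) ?_
    (hF.comp (measurable_const.add (measurable_const_smul _)))
  rw [hsqrt, portfolioCov_mul_transpose_inv hA]

instance matrixPolishSpace {m n : ℕ} : PolishSpace (Matrix (Fin m) (Fin n) ℝ) :=
  inferInstanceAs (PolishSpace (Fin m → Fin n → ℝ))

/-- On the closed cone of positive semidefinite matrices the square root is the inverse of an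
injective continuous map, so that the Lusin–Souslin theorem applies. -/
lemma measurable_matrix_sqrt (p : ℕ) :
    Measurable fun Q : Matrix (Fin p) (Fin p) ℝ => CFC.sqrt Q := by
  have hcone : MeasurableSet {Q : Matrix (Fin p) (Fin p) ℝ | Q.PosSemidef} :=
    isClosed_setOf_posSemidef.measurableSet
  refine measurable_of_restrict_of_restrict_compl hcone (fun s hs => ?_) ?_
  · have hinj : Set.InjOn (fun B : Matrix (Fin p) (Fin p) ℝ => B * B)
        (s ∩ {Q | Q.PosSemidef}) := fun B hB B' hB' h => by
      rw [← CFC.sqrt_mul_self B hB.2.nonneg, ← CFC.sqrt_mul_self B' hB'.2.nonneg]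
      exact congrArg CFC.sqrt h
    refine ⟨_, (hs.inter hcone).image_of_continuousOn_injOn
      (Continuous.continuousOn (by fun_prop)) hinj, ?_⟩
    ext ⟨Q, hQ⟩
    constructor
    · rintro ⟨B, ⟨hBs, hB⟩, rfl⟩
      simpa [CFC.sqrt_mul_self B hB.nonneg] using hBs
    · exact fun h => ⟨CFC.sqrt Q, ⟨h, (CFC.sqrt_nonneg Q).posSemidef⟩,
        CFC.sqrt_mul_sqrt_self Q hQ.nonneg⟩
  · convert measurable_const (a := (0 : Matrix (Fin p) (Fin p) ℝ)) using 1
    ext1 Q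
    exact CFC.sqrt_of_not_nonneg fun h => Q.2 h.posSemidef

/-! ### The multivariate `t`-distribution -/

/-- The matrix `S*(μ) = S + r (μ - m)(μ - m)ᵀ`, which is the scale of the conditional posterior of
`Σ` given `μ`. -/
def scaleStar {k : ℕ} (S : Matrix (Fin k) (Fin k) ℝ) (r : ℝ) (m μ : Fin k → ℝ) :
    Matrix (Fin k) (Fin k) ℝ :=
  S + r • vecMulVec (μ - m) (μ - m)

/-- The constant in the density of the `t`-distribution `t_k(d, a, A)`. -/
def multiTConst {k : ℕ} (d : ℝ) (A : Matrix (Fin k) (Fin k) ℝ) : ℝ :=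
  Real.Gamma ((d + k) / 2) /
    (Real.Gamma (d / 2) * (d * Real.pi) ^ ((k : ℝ) / 2) * A.det ^ ((1 : ℝ) / 2))

section

variable {k : ℕ} {S : Matrix (Fin k) (Fin k) ℝ}

lemma continuous_scaleStar (S : Matrix (Fin k) (Fin k) ℝ) (r : ℝ) (m : Fin k → ℝ) :
    Continuous (scaleStar S r m) := by
  unfold scaleStar
  simp only [vecMulVec_eq Unit]
  fun_prop

lemma posDef_scaleStar (hS : S.PosDef) {r : ℝ} (hr : 0 ≤ r) (m μ : Fin k → ℝ) :
    (scaleStar S r m μ).PosDef := by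
  refine hS.add_posSemidef (PosSemidef.smul ?_ hr)
  simpa using posSemidef_vecMulVec_self_star (μ - m)

lemma det_scaleStar (hS : S.det ≠ 0) (r : ℝ) (m μ : Fin k → ℝ) :
    (scaleStar S r m μ).det = S.det * (1 + r * ((μ - m) ⬝ᵥ (S⁻¹ *ᵥ (μ - m)))) := by
  have hfactor : scaleStar S r m μ =
      S * (1 + vecMulVec (r • (S⁻¹ *ᵥ (μ - m))) (μ - m)) := by
    rw [mul_add, mul_one, mul_vecMulVec, mulVec_smul, mulVec_mulVec,
      mul_nonsing_inv _ hS.isUnit, one_mulVec, smul_vecMulVec, scaleStar]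
  rw [hfactor, det_mul, vecMulVec_eq Unit, det_one_add_replicateCol_mul_replicateRow,
    dotProduct_smul, smul_eq_mul]

lemma dotProduct_inv_mulVec_nonneg (hS : S.PosDef) (u : Fin k → ℝ) : 0 ≤ u ⬝ᵥ (S⁻¹ *ᵥ u) := by
  simpa using hS.inv.posSemidef.dotProduct_mulVec_nonneg u

lemma lintegral_dotProduct_inv_mulVec (hS : S.PosDef) (m : Fin k → ℝ) {G : ℝ → ℝ≥0∞}
    (hG : Measurable G) :
    ∫⁻ y, G ((y - m) ⬝ᵥ (S⁻¹ *ᵥ (y - m))) =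
      ENNReal.ofReal (S.det ^ ((1 : ℝ) / 2)) * ∫⁻ y : Fin k → ℝ, G (y ⬝ᵥ y) := by
  set A := CFC.sqrt S
  have hAA : A * Aᵀ = S := sqrt_mul_transpose_sqrt hS.posSemidef
  have hA : A.det ≠ 0 := det_ne_zero_of_posDef_mul_transpose (hAA.symm ▸ hS)
  have hdet : |A.det| = S.det ^ ((1 : ℝ) / 2) := by
    rw [← hAA, det_mul, det_transpose, ← Real.sqrt_eq_rpow, Real.sqrt_mul_self_eq_abs]
  have hquad (y : Fin k → ℝ) : (A *ᵥ y) ⬝ᵥ (S⁻¹ *ᵥ (A *ᵥ y)) = y ⬝ᵥ y := by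
    rw [← hAA, Matrix.mul_inv_rev, mulVec_mulVec, mul_assoc, nonsing_inv_mul _ hA.isUnit, mul_one,
      ← vecMul_transpose, ← dotProduct_mulVec, mulVec_mulVec,
      mul_nonsing_inv _ (by simpa using hA), one_mulVec]
  have hmeas : Measurable fun y : Fin k → ℝ => G (y ⬝ᵥ (S⁻¹ *ᵥ y)) :=
    hG.comp (show Continuous fun y : Fin k → ℝ => y ⬝ᵥ (S⁻¹ *ᵥ y) by fun_prop).measurable
  rw [lintegral_sub_right_eq_self (fun y : Fin k → ℝ => G (y ⬝ᵥ (S⁻¹ *ᵥ y))) m,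
    lintegral_eq_det_mul_lintegral_mulVec hA hmeas, hdet]
  simp only [hquad]

lemma lintegral_exp_neg_mul_dotProduct_self (k : ℕ) {b : ℝ} (hb : 0 < b) :
    ∫⁻ y : Fin k → ℝ, ENNReal.ofReal (Real.exp (-(b * (y ⬝ᵥ y)))) =
      ENNReal.ofReal ((Real.pi / b) ^ ((k : ℝ) / 2)) := by
  have hsq : √(2 * b)⁻¹ ^ 2 = (2 * b)⁻¹ := Real.sq_sqrt (by positivity)
  have h := lintegral_exp_neg_dotProduct_self_mul (k := k) (a := √(2 * b)⁻¹) (by positivity)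
    (F := 1) measurable_const
  simp only [hsq, Pi.one_apply, mul_one, lintegral_one, measure_univ] at h
  convert h using 4 <;> field_simp

lemma lintegral_rpow_mul_exp_neg_mul_Ioi {a r : ℝ} (ha : 0 < a) (hr : 0 < r) :
    ∫⁻ η in Set.Ioi (0 : ℝ), ENNReal.ofReal (η ^ (a - 1) * Real.exp (-(r * η))) =
      ENNReal.ofReal (Real.Gamma a * r ^ (-a)) := by
  have := isProbabilityMeasure_gammaMeasure ha hr
  simpa using lintegral_rpow_mul_exp_neg_mul ha hr (G := 1) measurable_const

lemma lintegral_rpow_mul_exp_neg_mul_one_add (k : ℕ) {r δ η : ℝ} (hr : 0 < r) (hη : 0 < η) :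
    ∫⁻ y : Fin k → ℝ, ENNReal.ofReal
        (η ^ ((δ + k) / 2 - 1) * Real.exp (-((1 + r * (y ⬝ᵥ y)) * η))) =
      ENNReal.ofReal ((Real.pi / r) ^ ((k : ℝ) / 2)) *
        ENNReal.ofReal (η ^ (δ / 2 - 1) * Real.exp (-(1 * η))) := by
  have hkernel (q : ℝ) : η ^ ((δ + k) / 2 - 1) * Real.exp (-((1 + r * q) * η)) =
      η ^ ((δ + k) / 2 - 1) * Real.exp (-(1 * η)) * Real.exp (-(η * r * q)) := by
    rw [mul_assoc, ← Real.exp_add]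
    ring_nf
  have hpow : η ^ ((δ + k) / 2 - 1) * (Real.pi / (η * r)) ^ ((k : ℝ) / 2) =
      (Real.pi / r) ^ ((k : ℝ) / 2) * η ^ (δ / 2 - 1) := by
    rw [div_mul_eq_div_div_swap, Real.div_rpow (by positivity) hη.le, ← mul_div_assoc, mul_comm,
      mul_div_assoc, ← Real.rpow_sub hη]
    ring_nf
  have hconst : 0 ≤ η ^ ((δ + k) / 2 - 1) * Real.exp (-(1 * η)) := by positivity
  simp only [hkernel, ENNReal.ofReal_mul hconst]
  rw [lintegral_const_mul' _ _ ENNReal.ofReal_ne_top,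
    lintegral_exp_neg_mul_dotProduct_self k (mul_pos hη hr), ← ENNReal.ofReal_mul (by positivity),
    ← ENNReal.ofReal_mul (by positivity), mul_right_comm, hpow, mul_assoc]

/-- The function `q ↦ (1 + r q) ^ (-(δ + k) / 2)` is a mixture of the functions
`q ↦ exp (-η r q)` over Gamma distributed `η`. -/
lemma lintegral_one_add_mul_dotProduct_self_rpow (k : ℕ) {r δ : ℝ} (hr : 0 < r) (hδ : 0 < δ) :
    ∫⁻ y : Fin k → ℝ, ENNReal.ofReal ((1 + r * (y ⬝ᵥ y)) ^ (-(δ + k) / 2)) =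
      ENNReal.ofReal (Real.Gamma (δ / 2) * (Real.pi / r) ^ ((k : ℝ) / 2) /
        Real.Gamma ((δ + k) / 2)) := by
  have ha : 0 < (δ + k) / 2 := by positivity
  have hmixture (y : Fin k → ℝ) :
      ENNReal.ofReal ((1 + r * (y ⬝ᵥ y)) ^ (-(δ + k) / 2)) =
        ENNReal.ofReal (Real.Gamma ((δ + k) / 2))⁻¹ * ∫⁻ η in Set.Ioi (0 : ℝ),
          ENNReal.ofReal (η ^ ((δ + k) / 2 - 1) * Real.exp (-((1 + r * (y ⬝ᵥ y)) * η))) := by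
    have hsum : 0 ≤ y ⬝ᵥ y := Finset.sum_nonneg fun i _ => mul_self_nonneg _
    rw [lintegral_rpow_mul_exp_neg_mul_Ioi ha (by positivity), ← ENNReal.ofReal_mul (by positivity),
      inv_mul_cancel_left₀ (Real.Gamma_pos_of_pos ha).ne', neg_div]
  have hdot : Measurable fun q : (Fin k → ℝ) × ℝ => q.1 ⬝ᵥ q.1 :=
    (show Continuous fun q : (Fin k → ℝ) × ℝ => q.1 ⬝ᵥ q.1 by fun_prop).measurable
  have hmeas : Measurable fun q : (Fin k → ℝ) × ℝ => ENNReal.ofReal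
      (q.2 ^ ((δ + k) / 2 - 1) * Real.exp (-((1 + r * (q.1 ⬝ᵥ q.1)) * q.2))) :=
    Measurable.ennreal_ofReal (by fun_prop)
  simp only [hmixture]
  rw [lintegral_const_mul' _ _ ENNReal.ofReal_ne_top, lintegral_lintegral_swap hmeas.aemeasurable,
    setLIntegral_congr_fun measurableSet_Ioi fun η hη =>
      lintegral_rpow_mul_exp_neg_mul_one_add k hr hη,
    lintegral_const_mul' _ _ ENNReal.ofReal_ne_top,
    lintegral_rpow_mul_exp_neg_mul_Ioi (half_pos hδ) one_pos, Real.one_rpow,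
    ← ENNReal.ofReal_mul (by positivity), ← ENNReal.ofReal_mul (by positivity)]
  ring_nf

lemma multiTConst_pos {d : ℝ} (hd : 0 < d) (hS : S.PosDef) : 0 < multiTConst d S := by
  have := hS.det_pos
  unfold multiTConst
  positivity

lemma isProbabilityMeasure_multiT {d : ℝ} (hd : 0 < d) (a : Fin k → ℝ) (hS : S.PosDef) :
    IsProbabilityMeasure (multiT d a S) := by
  have hconst := multiTConst_pos hd hS
  have hdet := hS.det_pos
  have hkernel : Measurable fun q : ℝ => ENNReal.ofReal ((1 + d⁻¹ * q) ^ (-(d + k) / 2)) := by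
    fun_prop
  refine ⟨?_⟩
  rw [multiT, withDensity_apply _ MeasurableSet.univ, setLIntegral_univ, ← multiTConst]
  simp only [ENNReal.ofReal_mul hconst.le, div_eq_inv_mul (_ ⬝ᵥ _)]
  rw [lintegral_const_mul' _ _ ENNReal.ofReal_ne_top, lintegral_dotProduct_inv_mulVec hS a hkernel,
    lintegral_one_add_mul_dotProduct_self_rpow k (inv_pos.2 hd) hd,
    ← ENNReal.ofReal_mul (by positivity), ← ENNReal.ofReal_mul hconst.le, multiTConst,
    div_inv_eq_mul, mul_comm Real.pi, ENNReal.ofReal_eq_one]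
  field_simp

/-- By the matrix determinant lemma the density is, up to a constant, a power of `|S*(y)|`. -/
lemma multiT_eq_smul_withDensity (hS : S.PosDef) (m : Fin k → ℝ) {r δ : ℝ} (hr : 0 < r)
    (hδ : 0 < δ) :
    multiT δ m ((r * δ)⁻¹ • S) =
      ENNReal.ofReal (multiTConst δ ((r * δ)⁻¹ • S) * S.det ^ ((δ + k) / 2)) •
        volume.withDensity fun y =>
          ENNReal.ofReal ((scaleStar S r m y).det ^ (-(δ + k) / 2)) := by
  have hdet := hS.det_pos
  have hconst := multiTConst_pos hδ (hS.smul (inv_pos.2 (mul_pos hr hδ)))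
  have hinv : ((r * δ)⁻¹ • S)⁻¹ = (r * δ) • S⁻¹ := by
    refine inv_eq_right_inv ?_
    rw [smul_mul_smul_comm, mul_nonsing_inv _ hdet.ne'.isUnit, inv_mul_cancel₀ (by positivity),
      one_smul]
  rw [multiT, ← withDensity_smul' _ _ ENNReal.ofReal_ne_top, ← multiTConst]
  congr 1
  ext1 y
  have hq := dotProduct_inv_mulVec_nonneg hS (y - m)
  have hcancel : S.det ^ ((δ + k) / 2) * S.det ^ (-(δ + k) / 2) = 1 := by
    rw [← Real.rpow_add hdet, neg_div, add_neg_cancel, Real.rpow_zero]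
  have hscale : (y - m) ⬝ᵥ (((r * δ)⁻¹ • S)⁻¹ *ᵥ (y - m)) / δ =
      r * ((y - m) ⬝ᵥ (S⁻¹ *ᵥ (y - m))) := by
    rw [hinv, smul_mulVec, dotProduct_smul, smul_eq_mul]
    field_simp
  rw [Pi.smul_apply, smul_eq_mul, ← ENNReal.ofReal_mul (by positivity), det_scaleStar hdet.ne',
    Real.mul_rpow hdet.le (by positivity), hscale, mul_assoc, ← mul_assoc (S.det ^ _), hcancel,
    one_mul]

end

/-! ### The normal-inverse-Wishart distribution -/

/-- The unnormalized normal-inverse-Wishart law of `(μ, Σ)`, with density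
`|Σ|^(-(ν + k + 1)/2) exp(-tr(Σ⁻¹ S*(μ))/2)` where `S*(μ) = S + r (μ - m)(μ - m)ᵀ`. -/
def niwMeasure {k : ℕ} (ν : ℝ) (m : Fin k → ℝ) (r : ℝ) (S : Matrix (Fin k) (Fin k) ℝ) :
    Measure ((Fin k → ℝ) × Matrix (Fin k) (Fin k) ℝ) :=
  (refMeasure k).withDensity fun θ => ENNReal.ofReal (invWishartKernel ν (scaleStar S r m θ.1) θ.2)

/-- The normal-inverse-Wishart distribution, the common form of the two posteriors. -/
def normalInvWishart {k : ℕ} (ν : ℝ) (m : Fin k → ℝ) (r : ℝ) (S : Matrix (Fin k) (Fin k) ℝ) :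
    Measure ((Fin k → ℝ) × Matrix (Fin k) (Fin k) ℝ) :=
  (niwMeasure ν m r S Set.univ)⁻¹ • niwMeasure ν m r S

/-- The joint law of the independent variables `(η, z₀, μ)` of the stochastic representation. -/
def mixingLaw {k : ℕ} (p : ℕ) (ν : ℝ) (m : Fin k → ℝ) (r : ℝ) (S : Matrix (Fin k) (Fin k) ℝ) :
    Measure (ℝ × EuclideanSpace ℝ (Fin p) × (Fin k → ℝ)) :=
  (chiSquared ν).prod ((multivariateGaussian 0 1).prod (multiT (ν - k) m ((r * (ν - k))⁻¹ • S)))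

/-- The weights `L (C Σ⁻¹ (μ - ρ 𝟏))` of a portfolio as a function of `(μ, Σ)`. -/
def portfolioWeights {k p : ℕ} (C ρ : ℝ) (L : Matrix (Fin p) (Fin k) ℝ)
    (θ : (Fin k → ℝ) × Matrix (Fin k) (Fin k) ℝ) : Fin p → ℝ :=
  L *ᵥ (C • (θ.2⁻¹ *ᵥ (θ.1 - ρ • (1 : Fin k → ℝ))))

lemma ae_posDef_refMeasure (k : ℕ) : ∀ᵐ θ ∂refMeasure k, θ.2.PosDef :=
  Measure.quasiMeasurePreserving_snd.ae (ae_posDef_posDefVolume k)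

section

variable {k p : ℕ}

lemma measurable_invWishartKernel_scaleStar (ν : ℝ) (m : Fin k → ℝ) (r : ℝ)
    (S : Matrix (Fin k) (Fin k) ℝ) :
    Measurable fun θ : (Fin k → ℝ) × Matrix (Fin k) (Fin k) ℝ =>
      invWishartKernel ν (scaleStar S r m θ.1) θ.2 := by
  have htrace : Continuous fun q : Matrix (Fin k) (Fin k) ℝ × Matrix (Fin k) (Fin k) ℝ =>
      (q.1 * q.2).trace := by fun_prop
  have hdet : Measurable fun θ : (Fin k → ℝ) × Matrix (Fin k) (Fin k) ℝ => θ.2.det :=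
    (measurable_matrix_det k).comp measurable_snd
  have hpair : Measurable fun θ : (Fin k → ℝ) × Matrix (Fin k) (Fin k) ℝ =>
      (θ.2⁻¹, scaleStar S r m θ.1) :=
    ((measurable_matrix_inv k).comp measurable_snd).prodMk
      ((continuous_scaleStar S r m).measurable.comp measurable_fst)
  exact (hdet.pow_const _).mul ((htrace.measurable.fun_comp hpair).neg.div_const 2).exp

lemma measurable_portfolioWeights (C ρ : ℝ) (L : Matrix (Fin p) (Fin k) ℝ) :
    Measurable (portfolioWeights C ρ L) := by
  have hcont : Continuous fun q : Matrix (Fin k) (Fin k) ℝ × (Fin k → ℝ) =>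
      L *ᵥ (C • (q.1 *ᵥ (q.2 - ρ • (1 : Fin k → ℝ)))) := by fun_prop
  have hinv : Measurable fun θ : (Fin k → ℝ) × Matrix (Fin k) (Fin k) ℝ => (θ.2⁻¹, θ.1) :=
    ((measurable_matrix_inv k).comp measurable_snd).prodMk measurable_fst
  have hcomp := hcont.measurable.comp hinv
  simp only [Function.comp_def] at hcomp
  exact hcomp

lemma measurable_stochRep (C ρ : ℝ) (L : Matrix (Fin p) (Fin k) ℝ)
    {Sstar : (Fin k → ℝ) → Matrix (Fin k) (Fin k) ℝ} (hS : Measurable Sstar) :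
    Measurable (stochRep C ρ L Sstar) := by
  have hVv : Measurable fun ω : ℝ × EuclideanSpace ℝ (Fin p) × (Fin k → ℝ) =>
      ((Sstar ω.2.2)⁻¹, ω.2.2 - ρ • (1 : Fin k → ℝ)) :=
    ((measurable_matrix_inv k).comp (hS.comp measurable_snd.snd)).prodMk
      (measurable_snd.snd.sub_const _)
  have hmean : Continuous fun q : Matrix (Fin k) (Fin k) ℝ × (Fin k → ℝ) =>
      (L * q.1) *ᵥ q.2 := by fun_prop
  have hcov : Continuous fun q : Matrix (Fin k) (Fin k) ℝ × (Fin k → ℝ) =>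
      portfolioCov L q.1 q.2 := by
    unfold portfolioCov
    simp only [vecMulVec_eq Unit]
    fun_prop
  have hmulVec : Continuous fun q : Matrix (Fin p) (Fin p) ℝ × (Fin p → ℝ) => q.1 *ᵥ q.2 := by
    fun_prop
  have hz : Measurable fun ω : ℝ × EuclideanSpace ℝ (Fin p) × (Fin k → ℝ) => ω.2.1.ofLp := by
    fun_prop
  exact ((measurable_fst.const_mul C).smul (hmean.measurable.comp hVv)).add
    ((measurable_fst.sqrt.const_mul C).smul (hmulVec.measurable.comp
      (((measurable_matrix_sqrt p).comp (hcov.measurable.comp hVv)).prodMk hz)))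

lemma lintegral_invWishartKernel_portfolioWeights (hk : 0 < k) {ν : ℝ} (hν : 0 < ν) (C ρ : ℝ)
    (L : Matrix (Fin p) (Fin k) ℝ) {Sstar : (Fin k → ℝ) → Matrix (Fin k) (Fin k) ℝ}
    {μ : Fin k → ℝ} (hS : (Sstar μ).PosDef) {F : (Fin p → ℝ) → ℝ≥0∞} (hF : Measurable F) :
    ∫⁻ Q, ENNReal.ofReal (invWishartKernel ν (Sstar μ) Q) * F (portfolioWeights C ρ L (μ, Q))
        ∂posDefVolume k =
      invWishartMass k ν * (ENNReal.ofReal ((Sstar μ).det ^ (-ν / 2)) *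
        ∫⁻ η, ∫⁻ z, F (stochRep C ρ L Sstar (η, z, μ))
          ∂(multivariateGaussian 0 1) ∂chiSquared ν) := by
  simp only [portfolioWeights, mulVec_smul]
  rw [lintegral_invWishartKernel hk hν L hS (μ - ρ • 1) (hF.fun_comp (measurable_const_smul C))]
  have hrep (η : ℝ) (z : EuclideanSpace ℝ (Fin p)) : stochRep C ρ L Sstar (η, z, μ) =
      C • (η • ((L * (Sstar μ)⁻¹) *ᵥ (μ - ρ • 1)) +
        √η • (CFC.sqrt (portfolioCov L (Sstar μ)⁻¹ (μ - ρ • 1)) *ᵥ z.ofLp)) := by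
    rw [smul_add, smul_smul, smul_smul]
    rfl
  simp only [hrep, ← map_ofLp_multivariateGaussian_zero_one p]
  congr! 4 with η
  refine lintegral_map (hF.comp (Continuous.measurable ?_)) (by fun_prop)
  fun_prop

lemma lintegral_niwMeasure (hk : 0 < k) {ν r : ℝ} (hν : 0 < ν) (hr : 0 ≤ r) (m : Fin k → ℝ)
    {S : Matrix (Fin k) (Fin k) ℝ} (hS : S.PosDef) (C ρ : ℝ) (L : Matrix (Fin p) (Fin k) ℝ)
    {G : (Fin k → ℝ) × (Fin p → ℝ) → ℝ≥0∞} (hG : Measurable G) :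
    ∫⁻ θ, G (θ.1, portfolioWeights C ρ L θ) ∂niwMeasure ν m r S =
      ∫⁻ μ, invWishartMass k ν * (ENNReal.ofReal ((scaleStar S r m μ).det ^ (-ν / 2)) *
        ∫⁻ η, ∫⁻ z, G (μ, stochRep C ρ L (scaleStar S r m) (η, z, μ))
          ∂(multivariateGaussian 0 1) ∂chiSquared ν) := by
  have hkernel := (measurable_invWishartKernel_scaleStar ν m r S).ennreal_ofReal
  have hweights : Measurable fun θ => G (θ.1, portfolioWeights C ρ L θ) :=
    hG.comp (measurable_fst.prodMk (measurable_portfolioWeights C ρ L))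
  rw [niwMeasure, lintegral_withDensity_eq_lintegral_mul _ hkernel hweights]
  refine (lintegral_prod _ (hkernel.mul hweights).aemeasurable).trans ?_
  refine lintegral_congr fun μ => ?_
  exact lintegral_invWishartKernel_portfolioWeights hk hν C ρ L (posDef_scaleStar hS hr m μ)
    (hG.comp measurable_prodMk_left)

lemma isProbabilityMeasure_mixingLaw (p : ℕ) {ν r : ℝ} (hν : k < ν) (hr : 0 < r) (m : Fin k → ℝ)
    {S : Matrix (Fin k) (Fin k) ℝ} (hS : S.PosDef) :
    IsProbabilityMeasure (mixingLaw p ν m r S) := by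
  have hδ := sub_pos.2 hν
  have := isProbabilityMeasure_chiSquared (ν := ν) (by linarith [k.cast_nonneg (α := ℝ)])
  have := isProbabilityMeasure_multiT hδ m (hS.smul (inv_pos.2 (mul_pos hr hδ)))
  unfold mixingLaw
  infer_instance

lemma lintegral_mixingLaw {ν r : ℝ} (hν : k < ν) (hr : 0 < r) (m : Fin k → ℝ)
    {S : Matrix (Fin k) (Fin k) ℝ} (hS : S.PosDef)
    {H : ℝ × EuclideanSpace ℝ (Fin p) × (Fin k → ℝ) → ℝ≥0∞} (hH : Measurable H) :
    ∫⁻ ω, H ω ∂mixingLaw p ν m r S =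
      ∫⁻ μ, ∫⁻ η, ∫⁻ z, H (η, z, μ) ∂(multivariateGaussian 0 1) ∂chiSquared ν
        ∂multiT (ν - k) m ((r * (ν - k))⁻¹ • S) := by
  have hδ := sub_pos.2 hν
  have := isProbabilityMeasure_chiSquared (ν := ν) (by linarith [k.cast_nonneg (α := ℝ)])
  have := isProbabilityMeasure_multiT hδ m (hS.smul (inv_pos.2 (mul_pos hr hδ)))
  have hinner : Measurable fun q : (Fin k → ℝ) × ℝ =>
      ∫⁻ z, H (q.2, z, q.1) ∂(multivariateGaussian (0 : EuclideanSpace ℝ (Fin p)) 1) :=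
    (hH.comp (measurable_fst.snd.prodMk
      (measurable_snd.prodMk measurable_fst.fst))).lintegral_prod_right'
  rw [lintegral_lintegral_swap hinner.aemeasurable, mixingLaw, lintegral_prod _ hH.aemeasurable]
  exact lintegral_congr fun η =>
    lintegral_prod_symm _ (hH.comp measurable_prodMk_left).aemeasurable

lemma exists_multiT_eq_smul_withDensity {ν r : ℝ} (hν : k < ν) (hr : 0 < r) (m : Fin k → ℝ)
    {S : Matrix (Fin k) (Fin k) ℝ} (hS : S.PosDef) :
    ∃ b : ℝ≥0∞, b ≠ 0 ∧ b ≠ ∞ ∧ multiT (ν - k) m ((r * (ν - k))⁻¹ • S) =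
      b • volume.withDensity fun μ => ENNReal.ofReal ((scaleStar S r m μ).det ^ (-ν / 2)) := by
  have hδ := sub_pos.2 hν
  have h := multiT_eq_smul_withDensity hS m hr hδ
  rw [sub_add_cancel] at h
  refine ⟨_, (ENNReal.ofReal_pos.2 ?_).ne', ENNReal.ofReal_ne_top, h⟩
  exact mul_pos (multiTConst_pos hδ (hS.smul (inv_pos.2 (mul_pos hr hδ))))
    (Real.rpow_pos_of_pos hS.det_pos _)

lemma exists_map_niwMeasure_eq_smul (hk : 0 < k) {ν r : ℝ} (hν : k < ν) (hr : 0 < r)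
    (m : Fin k → ℝ) {S : Matrix (Fin k) (Fin k) ℝ} (hS : S.PosDef) (C ρ : ℝ)
    (L : Matrix (Fin p) (Fin k) ℝ) :
    ∃ c : ℝ≥0∞, c ≠ 0 ∧ c ≠ ∞ ∧
      (niwMeasure ν m r S).map (fun θ => (θ.1, portfolioWeights C ρ L θ)) =
        c • (mixingLaw p ν m r S).map (fun ω => (ω.2.2, stochRep C ρ L (scaleStar S r m) ω)) := by
  have hν0 : 0 < ν := by linarith [k.cast_nonneg (α := ℝ)]
  have := isProbabilityMeasure_chiSquared hν0
  have hstar := (continuous_scaleStar S r m).measurable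
  have hrep := measurable_stochRep C ρ L hstar
  obtain ⟨hmass, hmass'⟩ := invWishartMass_ne_zero_and_ne_top k (ν := ν) (by linarith)
  obtain ⟨b, hb, hb', hmultiT⟩ := exists_multiT_eq_smul_withDensity hν hr m hS
  refine ⟨invWishartMass k ν * b⁻¹, mul_ne_zero hmass (ENNReal.inv_ne_zero.2 hb'),
    ENNReal.mul_ne_top hmass' (ENNReal.inv_ne_top.2 hb), Measure.ext_of_lintegral _ fun G hG => ?_⟩
  have hGrep : Measurable fun ω : ℝ × EuclideanSpace ℝ (Fin p) × (Fin k → ℝ) =>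
      G (ω.2.2, stochRep C ρ L (scaleStar S r m) ω) :=
    hG.comp (measurable_snd.snd.prodMk hrep)
  have hcond : Measurable fun μ : Fin k → ℝ =>
      ∫⁻ η, ∫⁻ z, G (μ, stochRep C ρ L (scaleStar S r m) (η, z, μ))
        ∂(multivariateGaussian 0 1) ∂chiSquared ν :=
    (hGrep.comp (measurable_fst.snd.prodMk
      (measurable_snd.prodMk measurable_fst.fst))).lintegral_prod_right'.lintegral_prod_right'
  have hdens : Measurable fun μ : Fin k → ℝ =>
      ENNReal.ofReal ((scaleStar S r m μ).det ^ (-ν / 2)) :=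
    (((measurable_matrix_det k).comp hstar).pow_const _).ennreal_ofReal
  rw [lintegral_map hG (measurable_fst.prodMk (measurable_portfolioWeights C ρ L)),
    lintegral_smul_measure, lintegral_map hG (measurable_snd.snd.prodMk hrep),
    lintegral_niwMeasure hk hν0 hr.le m hS C ρ L hG, lintegral_mixingLaw hν hr m hS hGrep,
    hmultiT, lintegral_smul_measure, lintegral_withDensity_eq_lintegral_mul _ hdens hcond,
    lintegral_const_mul' _ _ hmass', smul_eq_mul, smul_eq_mul, mul_assoc, ← mul_assoc b⁻¹,
    ENNReal.inv_mul_cancel hb hb', one_mul]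
  simp only [Pi.mul_apply]

end

lemma identDistrib_inv_smul {Ω Ω' E : Type*} [MeasurableSpace Ω] [MeasurableSpace Ω']
    [MeasurableSpace E] {μ : Measure Ω} {P : Measure Ω'} [IsProbabilityMeasure P] {f : Ω → E}
    {g : Ω' → E} (hf : AEMeasurable f μ) (hg : AEMeasurable g P) {c : ℝ≥0∞} (hc : c ≠ 0)
    (hc' : c ≠ ∞) (h : μ.map f = c • P.map g) : IdentDistrib f g ((μ Set.univ)⁻¹ • μ) P := by
  have hmass : μ Set.univ = c := by
    have huniv := congrArg (fun κ => κ Set.univ) h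
    simpa only [Measure.map_apply_of_aemeasurable hf .univ, Measure.smul_apply,
      Measure.map_apply_of_aemeasurable hg .univ, Set.preimage_univ, measure_univ, smul_eq_mul,
      mul_one] using huniv
  refine ⟨hf.smul_measure _, hg, ?_⟩
  rw [Measure.map_smul, h, smul_smul, hmass, ENNReal.inv_mul_cancel hc hc', one_smul]

section

variable {k p : ℕ} {ν r : ℝ} {S : Matrix (Fin k) (Fin k) ℝ}

lemma identDistrib_prodMk_normalInvWishart (hk : 0 < k) (hν : k < ν) (hr : 0 < r) (m : Fin k → ℝ)
    (hS : S.PosDef) (C ρ : ℝ) (L : Matrix (Fin p) (Fin k) ℝ) :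
    IdentDistrib (fun θ => (θ.1, portfolioWeights C ρ L θ))
      (fun ω => (ω.2.2, stochRep C ρ L (scaleStar S r m) ω))
      (normalInvWishart ν m r S) (mixingLaw p ν m r S) := by
  have := isProbabilityMeasure_mixingLaw p hν hr m hS
  obtain ⟨c, hc, hc', hmap⟩ := exists_map_niwMeasure_eq_smul hk hν hr m hS C ρ L
  have hrep := measurable_stochRep C ρ L (continuous_scaleStar S r m).measurable
  exact identDistrib_inv_smul
    (measurable_fst.prodMk (measurable_portfolioWeights C ρ L)).aemeasurable
    (measurable_snd.snd.prodMk hrep).aemeasurable hc hc' hmap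

lemma identDistrib_normalInvWishart (hk : 0 < k) (hν : k < ν) (hr : 0 < r) (m : Fin k → ℝ)
    (hS : S.PosDef) (C ρ : ℝ) (L : Matrix (Fin p) (Fin k) ℝ) :
    IdentDistrib (portfolioWeights C ρ L) (stochRep C ρ L (scaleStar S r m))
      (normalInvWishart ν m r S) (mixingLaw p ν m r S) :=
  (identDistrib_prodMk_normalInvWishart hk hν hr m hS C ρ L).comp measurable_snd

lemma map_fst_normalInvWishart (hk : 0 < k) (hν : k < ν) (hr : 0 < r) (m : Fin k → ℝ)
    (hS : S.PosDef) :
    (normalInvWishart ν m r S).map Prod.fst = multiT (ν - k) m ((r * (ν - k))⁻¹ • S) := by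
  have hδ := sub_pos.2 hν
  have := isProbabilityMeasure_chiSquared (ν := ν) (by linarith [k.cast_nonneg (α := ℝ)])
  have := isProbabilityMeasure_multiT hδ m (hS.smul (inv_pos.2 (mul_pos hr hδ)))
  have h := ((identDistrib_prodMk_normalInvWishart hk hν hr m hS 0 0
    (0 : Matrix (Fin 0) (Fin k) ℝ)).comp measurable_fst).map_eq
  have hsnd : (Prod.fst ∘ fun ω => (ω.2.2, stochRep 0 0 (0 : Matrix (Fin 0) (Fin k) ℝ)
      (scaleStar S r m) ω)) = Prod.snd ∘ Prod.snd := rfl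
  rw [hsnd, ← Measure.map_map measurable_snd measurable_snd, mixingLaw, Measure.map_snd_prod,
    measure_univ, one_smul, Measure.map_snd_prod, measure_univ, one_smul] at h
  exact h

lemma isProbabilityMeasure_normalInvWishart (hk : 0 < k) (hν : k < ν) (hr : 0 < r) (m : Fin k → ℝ)
    (hS : S.PosDef) : IsProbabilityMeasure (normalInvWishart ν m r S) := by
  have hδ := sub_pos.2 hν
  have := isProbabilityMeasure_multiT hδ m (hS.smul (inv_pos.2 (mul_pos hr hδ)))
  rw [← map_fst_normalInvWishart hk hν hr m hS] at this
  exact Measure.isProbabilityMeasure_of_map Prod.fst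

end

/-! ### Conjugacy -/

section

variable {k n : ℕ}

lemma invWishartKernel_mul_invWishartKernel (ν ν' : ℝ) (A B : Matrix (Fin k) (Fin k) ℝ)
    {T : Matrix (Fin k) (Fin k) ℝ} (hT : T.PosDef) :
    invWishartKernel ν A T * invWishartKernel ν' B T =
      invWishartKernel (ν + ν' + k + 1) (A + B) T := by
  simp only [invWishartKernel]
  rw [mul_mul_mul_comm, ← Real.rpow_add hT.det_pos, ← Real.exp_add, mul_add, trace_add]
  ring_nf

lemma prod_invWishartKernel (ν : ℝ) (A : Fin n → Matrix (Fin k) (Fin k) ℝ)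
    {T : Matrix (Fin k) (Fin k) ℝ} (hT : T.PosDef) :
    ∏ i, invWishartKernel ν (A i) T =
      invWishartKernel (n * (ν + k + 1) - k - 1) (∑ i, A i) T := by
  simp only [invWishartKernel, Finset.prod_mul_distrib, Finset.prod_const, Finset.card_univ,
    Fintype.card_fin, ← Real.exp_sum]
  rw [← Real.rpow_mul_natCast hT.det_pos.le, Finset.mul_sum, trace_sum, ← Finset.sum_div,
    Finset.sum_neg_distrib]
  ring_nf

lemma exists_normalDensity_inv_smul_eq {r : ℝ} (hr : 0 < r) :
    ∃ c : ℝ, 0 < c ∧ ∀ (m y : Fin k → ℝ) (T : Matrix (Fin k) (Fin k) ℝ), T.PosDef →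
      normalDensity m (r⁻¹ • T) y =
        c * invWishartKernel (-k) (r • vecMulVec (y - m) (y - m)) T := by
  refine ⟨(2 * Real.pi) ^ (-(k : ℝ) / 2) * (r⁻¹ ^ k) ^ (-(1 : ℝ) / 2), by positivity,
    fun m y T hT => ?_⟩
  have hinv : (r⁻¹ • T)⁻¹ = r • T⁻¹ := by
    refine inv_eq_right_inv ?_
    rw [smul_mul_smul_comm, mul_nonsing_inv _ hT.det_pos.ne'.isUnit, inv_mul_cancel₀ hr.ne',
      one_smul]
  have hquad : (y - m) ⬝ᵥ ((r⁻¹ • T)⁻¹ *ᵥ (y - m)) =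
      (T⁻¹ * (r • vecMulVec (y - m) (y - m))).trace := by
    rw [hinv, Matrix.mul_smul, mul_vecMulVec, trace_smul, trace_vecMulVec, smul_mulVec,
      dotProduct_smul, dotProduct_comm]
  rw [normalDensity, hquad, det_smul, Fintype.card_fin,
    Real.mul_rpow (by positivity) hT.det_pos.le, invWishartKernel, neg_add_cancel, zero_add]
  ring

lemma multiGamma_pos {a : ℝ} (ha : k < 2 * a + 1) : 0 < multiGamma k a := by
  refine mul_pos (Real.rpow_pos_of_pos Real.pi_pos _) (Finset.prod_pos fun i _ => ?_)
  have hi : ((i : ℕ) : ℝ) + 1 ≤ k := by exact_mod_cast i.2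
  exact Real.Gamma_pos_of_pos (by linarith)

lemma exists_invWishartDensity_eq {d : ℝ} (hd : 2 * k < d) {Ψ : Matrix (Fin k) (Fin k) ℝ}
    (hΨ : Ψ.PosDef) :
    ∃ c : ℝ, 0 < c ∧ ∀ T, invWishartDensity d Ψ T = c * invWishartKernel (d - k - 1) Ψ T := by
  have hdet := hΨ.det_pos
  have hΓ : 0 < multiGamma k ((d - k - 1) / 2) := multiGamma_pos (by linarith)
  refine ⟨Ψ.det ^ ((d - k - 1) / 2) /
    (2 ^ ((k : ℝ) * (d - k - 1) / 2) * multiGamma k ((d - k - 1) / 2)), by positivity, fun T => ?_⟩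
  rw [invWishartDensity, invWishartKernel, mul_assoc]
  ring_nf

lemma sum_sub_sampleMean (x : Fin n → Fin k → ℝ) : ∑ i, (x i - sampleMean x) = 0 := by
  rcases eq_or_ne n 0 with rfl | hn
  · simp
  · have hn' : (n : ℝ) ≠ 0 := by exact_mod_cast hn
    rw [Finset.sum_sub_distrib, Finset.sum_const, Finset.card_univ, Fintype.card_fin, sampleMean,
      ← Nat.cast_smul_eq_nsmul ℝ, smul_smul, mul_inv_cancel₀ hn', one_smul, sub_self]

lemma scaleD_eq_sum (x : Fin n → Fin k → ℝ) :
    scaleD x = ∑ i, vecMulVec (x i - sampleMean x) (x i - sampleMean x) := by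
  rcases eq_or_ne n 1 with rfl | hn
  · simp [scaleD, sampleMean]
  · have hn' : (n : ℝ) - 1 ≠ 0 := sub_ne_zero.2 (by exact_mod_cast hn)
    rw [scaleD, sampleCov, smul_smul, mul_inv_cancel₀ hn', one_smul]

lemma posSemidef_scaleD (x : Fin n → Fin k → ℝ) : (scaleD x).PosSemidef := by
  rw [scaleD_eq_sum]
  exact posSemidef_sum _ fun i _ => by
    simpa using posSemidef_vecMulVec_self_star (x i - sampleMean x)

lemma sum_vecMulVec_sub (x : Fin n → Fin k → ℝ) (μ : Fin k → ℝ) :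
    ∑ i, vecMulVec (x i - μ) (x i - μ) = scaleDStar x μ := by
  have hbinomial (i : Fin n) : vecMulVec (x i - μ) (x i - μ) =
      vecMulVec (x i - sampleMean x) (x i - sampleMean x) -
        vecMulVec (x i - sampleMean x) (μ - sampleMean x) -
        vecMulVec (μ - sampleMean x) (x i - sampleMean x) +
        vecMulVec (μ - sampleMean x) (μ - sampleMean x) := by
    ext a b
    simp only [Matrix.add_apply, Matrix.sub_apply, vecMulVec_apply, Pi.sub_apply]
    ring
  have hcoord (j : Fin k) : ∑ i, (x i - sampleMean x) j = 0 := by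
    rw [← Finset.sum_apply, sum_sub_sampleMean, Pi.zero_apply]
  have hleft : ∑ i, vecMulVec (x i - sampleMean x) (μ - sampleMean x) = 0 := by
    ext a b
    simp only [Matrix.sum_apply, vecMulVec_apply, ← Finset.sum_mul, hcoord, zero_mul,
      Matrix.zero_apply]
  have hright : ∑ i, vecMulVec (μ - sampleMean x) (x i - sampleMean x) = 0 := by
    ext a b
    simp only [Matrix.sum_apply, vecMulVec_apply, ← Finset.mul_sum, hcoord, mul_zero,
      Matrix.zero_apply]
  simp only [hbinomial, Finset.sum_add_distrib, Finset.sum_sub_distrib, hleft, hright, sub_zero]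
  rw [scaleDStar, ← scaleD_eq_sum, Finset.sum_const, Finset.card_univ, Fintype.card_fin,
    Nat.cast_smul_eq_nsmul]

lemma exists_likelihood_eq (x : Fin n → Fin k → ℝ) :
    ∃ c : ℝ, 0 < c ∧ ∀ θ : (Fin k → ℝ) × Matrix (Fin k) (Fin k) ℝ, θ.2.PosDef →
      likelihood x θ = c * invWishartKernel (n - k - 1) (scaleDStar x θ.1) θ.2 := by
  obtain ⟨c, hc, hdensity⟩ := exists_normalDensity_inv_smul_eq (k := k) one_pos
  refine ⟨c ^ n, pow_pos hc n, fun θ hθ => ?_⟩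
  simp only [inv_one, one_smul] at hdensity
  simp only [likelihood, hdensity _ _ _ hθ, Finset.prod_mul_distrib, Finset.prod_const,
    Finset.card_univ, Fintype.card_fin]
  rw [prod_invWishartKernel _ _ hθ, sum_vecMulVec_sub, neg_add_cancel, zero_add, mul_one]

lemma scaleStar_add_scaleDStar (m₀ : Fin k → ℝ) {r₀ : ℝ} (hr₀ : n + r₀ ≠ 0)
    (S₀ : Matrix (Fin k) (Fin k) ℝ) (x : Fin n → Fin k → ℝ) (μ : Fin k → ℝ) :
    scaleStar S₀ r₀ m₀ μ + scaleDStar x μ =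
      scaleStar (scaleC m₀ r₀ S₀ x) (n + r₀) (meanC m₀ r₀ x) μ := by
  ext i j
  simp only [scaleStar, scaleC, scaleDStar, meanC, Matrix.add_apply, Matrix.smul_apply,
    vecMulVec_apply, Pi.sub_apply, Pi.smul_apply, Pi.add_apply, smul_eq_mul]
  field_simp
  ring

lemma posDef_scaleC (m₀ : Fin k → ℝ) {r₀ : ℝ} (hr₀ : 0 ≤ r₀) {S₀ : Matrix (Fin k) (Fin k) ℝ}
    (hS₀ : S₀.PosDef) (x : Fin n → Fin k → ℝ) : (scaleC m₀ r₀ S₀ x).PosDef :=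
  posDef_scaleStar (hS₀.posSemidef_add (posSemidef_scaleD x)) (by positivity) (sampleMean x) m₀

lemma exists_niwMeasure_withDensity_likelihood (ν : ℝ) (m₀ : Fin k → ℝ) {r₀ : ℝ}
    (hr₀ : n + r₀ ≠ 0) (S₀ : Matrix (Fin k) (Fin k) ℝ) (x : Fin n → Fin k → ℝ) :
    ∃ c : ℝ≥0∞, c ≠ 0 ∧ c ≠ ∞ ∧
      (niwMeasure ν m₀ r₀ S₀).withDensity (fun θ => ENNReal.ofReal (likelihood x θ)) =
        c • niwMeasure (n + ν) (meanC m₀ r₀ x) (n + r₀) (scaleC m₀ r₀ S₀ x) := by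
  obtain ⟨c, hc, hlikelihood⟩ := exists_likelihood_eq x
  refine ⟨ENNReal.ofReal c, (ENNReal.ofReal_pos.2 hc).ne', ENNReal.ofReal_ne_top, ?_⟩
  have hae := ae_posDef_refMeasure k
  have hprior := (measurable_invWishartKernel_scaleStar ν m₀ r₀ S₀).ennreal_ofReal
  have hdata : Measurable fun θ : (Fin k → ℝ) × Matrix (Fin k) (Fin k) ℝ =>
      ENNReal.ofReal (c * invWishartKernel (n - k - 1) (scaleDStar x θ.1) θ.2) :=
    ((measurable_invWishartKernel_scaleStar (n - k - 1) (sampleMean x) n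
      (scaleD x)).const_mul c).ennreal_ofReal
  have hlikelihood_ae : (fun θ => ENNReal.ofReal (likelihood x θ)) =ᵐ[niwMeasure ν m₀ r₀ S₀]
      fun θ => ENNReal.ofReal (c * invWishartKernel (n - k - 1) (scaleDStar x θ.1) θ.2) :=
    (withDensity_absolutelyContinuous _ _).ae_eq
      (hae.mono fun θ hθ => congrArg ENNReal.ofReal (hlikelihood θ hθ))
  rw [withDensity_congr_ae hlikelihood_ae, niwMeasure, ← withDensity_mul _ hprior hdata, niwMeasure,
    ← withDensity_smul' _ _ ENNReal.ofReal_ne_top]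
  refine withDensity_congr_ae (hae.mono fun θ hθ => ?_)
  have hdet := hθ.det_pos
  have hkernel : 0 ≤ invWishartKernel ν (scaleStar S₀ r₀ m₀ θ.1) θ.2 := by
    unfold invWishartKernel
    positivity
  rw [Pi.mul_apply, Pi.smul_apply, smul_eq_mul, ← ENNReal.ofReal_mul hkernel,
    ← ENNReal.ofReal_mul hc.le, mul_left_comm, invWishartKernel_mul_invWishartKernel _ _ _ _ hθ,
    scaleStar_add_scaleDStar m₀ hr₀ S₀ x]
  ring_nf

lemma posterior_smul_niwMeasure {c : ℝ≥0∞} (hc : c ≠ 0) (hc' : c ≠ ∞) (ν : ℝ) (m₀ : Fin k → ℝ)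
    {r₀ : ℝ} (hr₀ : n + r₀ ≠ 0) (S₀ : Matrix (Fin k) (Fin k) ℝ) (x : Fin n → Fin k → ℝ) :
    posterior (c • niwMeasure ν m₀ r₀ S₀) x =
      normalInvWishart (n + ν) (meanC m₀ r₀ x) (n + r₀) (scaleC m₀ r₀ S₀ x) := by
  obtain ⟨b, hb, hb', hbayes⟩ := exists_niwMeasure_withDensity_likelihood ν m₀ hr₀ S₀ x
  have hcb : c * b ≠ 0 := mul_ne_zero hc hb
  have hcb' : c * b ≠ ∞ := ENNReal.mul_ne_top hc' hb'
  rw [posterior, ← setLIntegral_univ, ← withDensity_apply _ .univ, withDensity_smul_measure, hbayes,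
    smul_smul c b, Measure.smul_apply, smul_smul, smul_eq_mul, normalInvWishart,
    ENNReal.mul_inv (.inl hcb) (.inl hcb'), mul_right_comm, ENNReal.inv_mul_cancel hcb hcb',
    one_mul]

/-- The diffuse prior is the improper case `ν = 0`, `r₀ = 0`, `S₀ = 0` of the conjugate family. -/
lemma diffusePrior_eq_niwMeasure (k : ℕ) : diffusePrior k = niwMeasure 0 0 0 0 := by
  simp [diffusePrior, niwMeasure, invWishartKernel, scaleStar]

lemma posterior_diffusePrior (hn : n ≠ 0) (x : Fin n → Fin k → ℝ) :
    posterior (diffusePrior k) x = normalInvWishart n (sampleMean x) n (scaleD x) := by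
  have hn' : (n : ℝ) ≠ 0 := by exact_mod_cast hn
  have hmean : meanC 0 0 x = sampleMean x := by simp [meanC, hn']
  have hscale : scaleC 0 0 0 x = scaleD x := by simp [scaleC]
  rw [diffusePrior_eq_niwMeasure, ← one_smul ℝ≥0∞ (niwMeasure _ _ _ _),
    posterior_smul_niwMeasure one_ne_zero ENNReal.one_ne_top 0 0 (by simpa using hn') 0 x, hmean,
    hscale, add_zero]

lemma exists_conjugatePrior_eq_smul (m₀ : Fin k → ℝ) {r₀ d₀ : ℝ} (hr₀ : 0 < r₀)
    (hd₀ : 2 * k < d₀) {S₀ : Matrix (Fin k) (Fin k) ℝ} (hS₀ : S₀.PosDef) :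
    ∃ c : ℝ≥0∞, c ≠ 0 ∧ c ≠ ∞ ∧
      conjugatePrior m₀ r₀ d₀ S₀ = c • niwMeasure (d₀ - k) m₀ r₀ S₀ := by
  obtain ⟨a, ha, hnormal⟩ := exists_normalDensity_inv_smul_eq (k := k) hr₀
  obtain ⟨b, hb, hwishart⟩ := exists_invWishartDensity_eq hd₀ hS₀
  refine ⟨ENNReal.ofReal (a * b), (ENNReal.ofReal_pos.2 (mul_pos ha hb)).ne',
    ENNReal.ofReal_ne_top, ?_⟩
  rw [conjugatePrior, niwMeasure, ← withDensity_smul' _ _ ENNReal.ofReal_ne_top]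
  refine withDensity_congr_ae ((ae_posDef_refMeasure k).mono fun θ hθ => ?_)
  beta_reduce
  rw [Pi.smul_apply, smul_eq_mul, ← ENNReal.ofReal_mul (by positivity), hnormal _ _ _ hθ, hwishart,
    mul_mul_mul_comm, invWishartKernel_mul_invWishartKernel _ _ _ _ hθ, scaleStar, add_comm S₀]
  ring_nf

lemma posterior_conjugatePrior (m₀ : Fin k → ℝ) {r₀ d₀ : ℝ} (hr₀ : 0 < r₀) (hd₀ : 2 * k < d₀)
    {S₀ : Matrix (Fin k) (Fin k) ℝ} (hS₀ : S₀.PosDef) (x : Fin n → Fin k → ℝ) :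
    posterior (conjugatePrior m₀ r₀ d₀ S₀) x =
      normalInvWishart (n + d₀ - k) (meanC m₀ r₀ x) (n + r₀) (scaleC m₀ r₀ S₀ x) := by
  obtain ⟨c, hc, hc', hprior⟩ := exists_conjugatePrior_eq_smul m₀ hr₀ hd₀ hS₀
  rw [hprior, posterior_smul_niwMeasure hc hc' _ _ (by positivity), add_sub_assoc]

end

end BayesPortfolio

end

open BayesPortfolio in
theorem theorem1_general {k n p : ℕ} (hk : 0 < k) (L : Matrix (Fin p) (Fin k) ℝ)
    (x : Fin n → Fin k → ℝ) (C ρ : ℝ) :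
    (k < n → (scaleD x).PosDef →
      IsProbabilityMeasure (posterior (diffusePrior k) x) ∧
      (posterior (diffusePrior k) x).map Prod.fst =
        multiT ((n : ℝ) - k) (sampleMean x) (((n : ℝ) * ((n : ℝ) - k))⁻¹ • scaleD x) ∧
      IdentDistrib (portfolioWeights C ρ L) (stochRep C ρ L (scaleDStar x))
        (posterior (diffusePrior k) x)
        ((chiSquared n).prod ((multivariateGaussian 0 1).prod
          (multiT ((n : ℝ) - k) (sampleMean x) (((n : ℝ) * ((n : ℝ) - k))⁻¹ • scaleD x))))) ∧
    (∀ (m₀ : Fin k → ℝ) (r₀ d₀ : ℝ) (S₀ : Matrix (Fin k) (Fin k) ℝ),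
      0 < r₀ → 2 * (k : ℝ) < d₀ → S₀.PosDef →
      IsProbabilityMeasure (posterior (conjugatePrior m₀ r₀ d₀ S₀) x) ∧
      (posterior (conjugatePrior m₀ r₀ d₀ S₀) x).map Prod.fst =
        multiT ((n : ℝ) + d₀ - 2 * k) (meanC m₀ r₀ x)
          ((((n : ℝ) + r₀) * ((n : ℝ) + d₀ - 2 * k))⁻¹ • scaleC m₀ r₀ S₀ x) ∧
      IdentDistrib (portfolioWeights C ρ L) (stochRep C ρ L (scaleCStar m₀ r₀ S₀ x))
        (posterior (conjugatePrior m₀ r₀ d₀ S₀) x)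
        ((chiSquared ((n : ℝ) + d₀ - k)).prod ((multivariateGaussian 0 1).prod
          (multiT ((n : ℝ) + d₀ - 2 * k) (meanC m₀ r₀ x)
            ((((n : ℝ) + r₀) * ((n : ℝ) + d₀ - 2 * k))⁻¹ • scaleC m₀ r₀ S₀ x))))) := by
  refine ⟨fun hkn hS => ?_, fun m₀ r₀ d₀ S₀ hr₀ hd₀ hS₀ => ?_⟩
  · have hν : (k : ℝ) < n := by exact_mod_cast hkn
    have hr : (0 : ℝ) < n := by linarith [k.cast_nonneg (α := ℝ)]
    rw [posterior_diffusePrior (by lia)]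
    exact ⟨isProbabilityMeasure_normalInvWishart hk hν hr _ hS,
      map_fst_normalInvWishart hk hν hr _ hS, identDistrib_normalInvWishart hk hν hr _ hS C ρ L⟩
  · have hν : (k : ℝ) < n + d₀ - k := by linarith [n.cast_nonneg (α := ℝ)]
    have hr : (0 : ℝ) < n + r₀ := by positivity
    have hSc := posDef_scaleC m₀ hr₀.le hS₀ x
    have hdof : (n : ℝ) + d₀ - 2 * k = n + d₀ - k - k := by ring
    rw [posterior_conjugatePrior m₀ hr₀ hd₀ hS₀, hdof]
    exact ⟨isProbabilityMeasure_normalInvWishart hk hν hr _ hSc,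
      map_fst_normalInvWishart hk hν hr _ hSc, identDistrib_normalInvWishart hk hν hr _ hSc C ρ L⟩

open BayesPortfolio in
/-- Both parts assert that the posterior is a probability measure, that its `μ`-marginal is the
stated `t`-distribution, and that `L w_t` under the posterior is equal in distribution to the
representation built from mutually independent `η`, `z₀`, `μ` with the stated laws. -/
theorem theorem1 {k n p : ℕ} (hk : 0 < k) (hn : k < n)
    (L : Matrix (Fin p) (Fin k) ℝ) (x : Fin n → Fin k → ℝ)
    (γ : ℝ) (hγ : 0 < γ) (W rf : ℕ → ℝ) (T t : ℕ) (ht : t < T) :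
    ((scaleD x).PosDef →
      IsProbabilityMeasure (posterior (diffusePrior k) x) ∧
      (posterior (diffusePrior k) x).map Prod.fst =
        multiT ((n : ℝ) - k) (sampleMean x) (((n : ℝ) * ((n : ℝ) - k))⁻¹ • scaleD x) ∧
      IdentDistrib
        (fun θ => L *ᵥ optWeights γ W rf T t θ)
        (stochRep (riskCoeff γ W rf T t) (rf (t + 1)) L (scaleDStar x))
        (posterior (diffusePrior k) x)
        ((chiSquared n).prod ((multivariateGaussian 0 1).prod
          (multiT ((n : ℝ) - k) (sampleMean x) (((n : ℝ) * ((n : ℝ) - k))⁻¹ • scaleD x))))) ∧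
    (∀ (m₀ : Fin k → ℝ) (r₀ d₀ : ℝ) (S₀ : Matrix (Fin k) (Fin k) ℝ),
      0 < r₀ → 2 * (k : ℝ) < d₀ → S₀.PosDef →
      IsProbabilityMeasure (posterior (conjugatePrior m₀ r₀ d₀ S₀) x) ∧
      (posterior (conjugatePrior m₀ r₀ d₀ S₀) x).map Prod.fst =
        multiT ((n : ℝ) + d₀ - 2 * k) (meanC m₀ r₀ x)
          ((((n : ℝ) + r₀) * ((n : ℝ) + d₀ - 2 * k))⁻¹ • scaleC m₀ r₀ S₀ x) ∧
      IdentDistrib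
        (fun θ => L *ᵥ optWeights γ W rf T t θ)
        (stochRep (riskCoeff γ W rf T t) (rf (t + 1)) L (scaleCStar m₀ r₀ S₀ x))
        (posterior (conjugatePrior m₀ r₀ d₀ S₀) x)
        ((chiSquared ((n : ℝ) + d₀ - k)).prod ((multivariateGaussian 0 1).prod
          (multiT ((n : ℝ) + d₀ - 2 * k) (meanC m₀ r₀ x)
            ((((n : ℝ) + r₀) * ((n : ℝ) + d₀ - 2 * k))⁻¹ • scaleC m₀ r₀ S₀ x))))) := by
  have h := theorem1_general hk L x (riskCoeff γ W rf T t) (rf (t + 1))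
  exact ⟨h.1 hn, h.2⟩
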